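/- Fix $q\in(1/2,1)$ and $\varepsilon\in(0,1)$, and let $p:\mathbb N\to[0,1]$ satisfy $1-p(n)=O(n^{\varepsilon})/n$ as $n\to\infty$. Let $G(n,p(n))$ be the Erdős–Rényi random graph on $n$ vertices (each pair of vertices is joined independently with probability $p(n)$). Model. Let $G$ be a graph on $n$ vertices (agents) and $\sigma$ a decision order (a permutation of the vertices). The ground truth $\theta\in\{0,1\}$ is a fair bit; given $\theta$, the agents' private signals $s_v\in\{0,1\}$ are independent and equal to $\theta$ with probability $q$. In the order $\sigma$, each agent $v$ takes an action $a_v\in\{0,1\}$. Under the Bayesian model, $a_v$ is a function of $s_v$ and of the actions of those neighbours of $v$ in $G$ that precede $v$ in $\sigma$, and it is a most likely value of $\theta$ given this information, where $v$ knows $G$, $\sigma$ and the rules by which the other agents decide; ties are broken by an arbitrary deterministic rule. The learning quality is $L_\sigma(G)=\frac1n\sum_v\mathbb P(a_v=\theta)$; let $L(G)$ be its maximum over all orders $\sigma$ (and all ways of breaking ties). The family $\{G(n,p(n))\}$ achieves asymptotic truth learning under the Bayesian model if $\mathbb E\,[L(G(n,p(n)))]\to1$ as $n\to\infty$. Then the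 following hold. 1. The family $\{G(n,p(n))\}$ does not achieve asymptotic truth learning under the Bayesian model. 2. There is a constant $K$ such that, with probability tending to $1$ as $n\to\infty$, every induced forest of $G(n,p(n))$ has at most $K$ vertices, and in every order $\sigma$ at most $K$ vertices have fewer than two neighbours that precede them. 3. Herding on the wrong value occurs with constant probability: there are constants $c>0$ and $K$ such that for every $\beta>0$, with probability tending to $1$ as $n\to\infty$, the graph $G=G(n,p(n))$ has the following property. For every order $\sigma$ and every way of breaking ties, with probability at least $c$ over $\theta$ and the private signals, all but at most $K$ agents ignore their private signals (the opposite signal, with the same observed actions, would lead to the same action) and at most $\beta n$ agents predict $\theta$ correctly. -/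

import Mathlib

open Filter Topology Asymptotics

noncomputable section

/-- Joint law of the ground truth `θ` (a fair bit) and the private signals `s`, which are,
given `θ`, independent and equal to `θ` with probability `q`. -/
def jointWeight {n : ℕ} (q : ℝ) (θ : Bool) (s : Fin n → Bool) : ℝ :=
  (1 / 2) * ∏ v, if s v = θ then q else 1 - q

/-- Probability of an event about the ground truth and the private signals. -/
def signalProb {n : ℕ} (q : ℝ) (E : Bool → (Fin n → Bool) → Prop) : ℝ :=
  open Classical in
  ∑ θ : Bool, ∑ s : Fin n → Bool, if E θ s then jointWeight q θ s else 0

/-- The neighbours of `v` that decide before `v`, where `σ v` is the position of `v` in the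
decision order. -/
def earlierNeighbors {n : ℕ} (G : SimpleGraph (Fin n)) (σ : Equiv.Perm (Fin n)) (v : Fin n) :
    Finset (Fin n) :=
  open Classical in
  Finset.univ.filter fun u => G.Adj u v ∧ σ u < σ v

/-- Two signal profiles give `v` the same information: `v` receives the same private signal and
observes the same actions of its earlier neighbours. Here `a u s` is the action of agent `u`
when the private signals of all agents are `s`. -/
def SameInfo {n : ℕ} (G : SimpleGraph (Fin n)) (σ : Equiv.Perm (Fin n))
    (a : Fin n → (Fin n → Bool) → Bool) (v : Fin n) (s t : Fin n → Bool) : Prop :=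
  s v = t v ∧ ∀ u ∈ earlierNeighbors G σ v, a u s = a u t

/-- The actions `a` are played according to the Bayesian model in the learning network `(G, q, σ)`:
every action is a function of the information of the agent, and is a most likely value of the
ground truth given that information (ties may be broken in any way). -/
structure IsBayesianPlay {n : ℕ} (G : SimpleGraph (Fin n)) (q : ℝ) (σ : Equiv.Perm (Fin n))
    (a : Fin n → (Fin n → Bool) → Bool) : Prop where
  adapted : ∀ v s t, SameInfo G σ a v s t → a v s = a v t
  optimal : ∀ v s, signalProb q (fun θ t => θ = !(a v s) ∧ SameInfo G σ a v s t) ≤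
    signalProb q (fun θ t => θ = a v s ∧ SameInfo G σ a v s t)

/-- Learning quality of the network: the average over the agents of the probability that
the action is correct. -/
def learningQuality {n : ℕ} (q : ℝ) (a : Fin n → (Fin n → Bool) → Bool) : ℝ :=
  (1 / (n : ℝ)) * ∑ v : Fin n, signalProb q (fun θ s => a v s = θ)

/-- Learning quality of `G` in the Bayesian model under the best decision order
(and the best way of breaking ties). -/
def optimalLearningQuality {n : ℕ} (q : ℝ) (G : SimpleGraph (Fin n)) : ℝ :=
  sSup {L : ℝ | ∃ (σ : Equiv.Perm (Fin n)) (a : Fin n → (Fin n → Bool) → Bool),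
    IsBayesianPlay G q σ a ∧ L = learningQuality q a}

/-- Expected optimal learning quality of the Erdős–Rényi graph `G(n, p)`: the sum over all graphs
on `n` vertices of the probability of the graph times its optimal learning quality. -/
def erLearningQuality (q : ℝ) (n : ℕ) (p : unitInterval) : ℝ :=
  open Classical in
  ∑ G : SimpleGraph (Fin n),
    (SimpleGraph.binomialRandom (Fin n) p).real {G} * optimalLearningQuality q G

/-- The family `G(n, p n)` achieves asymptotic truth learning under the Bayesian model: the expected
learning quality, under a best order for each graph, tends to one. -/
def ERAchievesTruthLearning (q : ℝ) (p : ℕ → unitInterval) : Prop :=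
  Tendsto (fun n : ℕ => erLearningQuality q n (p n)) atTop (𝓝 1)

/-- The agent `v` ignores its private signal at the signal profile `s`: reversing that signal
alone does not change its action (nor what it observes, since earlier actions do not depend
on it). -/
def IgnoresSignal {n : ℕ} (a : Fin n → (Fin n → Bool) → Bool) (v : Fin n)
    (s : Fin n → Bool) : Prop :=
  a v (Function.update s v (!(s v))) = a v s

/-- Herding on the wrong state: all but at most `K` agents ignore their private signals, and all
but at most a fraction `β` of the agents predict wrongly. -/
def WrongHerd {n : ℕ} (K : ℕ) (β : ℝ) (a : Fin n → (Fin n → Bool) → Bool) (θ : Bool)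
    (s : Fin n → Bool) : Prop :=
  {v | ¬ IgnoresSignal a v s}.ncard ≤ K ∧ ({v | a v s = θ}.ncard : ℝ) ≤ β * n

/-- In every learning network the Bayesian model can be played. -/
theorem exists_isBayesianPlay {n : ℕ} (G : SimpleGraph (Fin n)) (q : ℝ)
    (σ : Equiv.Perm (Fin n)) : ∃ a, IsBayesianPlay G q σ a := by
  classical
  have key : ∀ k : ℕ, ∃ a : Fin n → (Fin n → Bool) → Bool, ∀ v, (σ v : ℕ) < k →
      (∀ s t, SameInfo G σ a v s t → a v s = a v t) ∧
      ∀ s, signalProb q (fun θ t => θ = !(a v s) ∧ SameInfo G σ a v s t) ≤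
        signalProb q (fun θ t => θ = a v s ∧ SameInfo G σ a v s t) := by
    intro k
    induction k with
    | zero => exact ⟨fun _ _ => true, fun v hv => absurd hv (Nat.not_lt_zero _)⟩
    | succ k ih =>
      obtain ⟨a, ha⟩ := ih
      let b : Fin n → (Fin n → Bool) → Bool := fun v s =>
        if (σ v : ℕ) = k then
          decide (signalProb q (fun θ t => θ = false ∧ SameInfo G σ a v s t) ≤
            signalProb q (fun θ t => θ = true ∧ SameInfo G σ a v s t))
        else a v s
      have hb : ∀ v, (σ v : ℕ) ≤ k → SameInfo G σ b v = SameInfo G σ a v := by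
        intro v hv
        have h : ∀ u ∈ earlierNeighbors G σ v, b u = a u := by
          intro u hu
          have hu' : σ u < σ v := by
            simp only [earlierNeighbors, Finset.mem_filter] at hu
            exact hu.2.2
          have : (σ u : ℕ) ≠ k := by
            have := Fin.lt_def.mp hu'
            omega
          funext s
          simp [b, this]
        funext s t
        refine propext (and_congr_right fun _ => forall₂_congr fun u hu => ?_)
        rw [h u hu]
      refine ⟨b, fun v hv => ?_⟩
      rw [hb v (by omega)]
      by_cases hk : (σ v : ℕ) = k
      · refine ⟨fun s t hst => ?_, fun s => ?_⟩
        · have : SameInfo G σ a v s = SameInfo G σ a v t := by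
            funext r
            exact propext ⟨fun h => ⟨hst.1.symm.trans h.1,
              fun u hu => (hst.2 u hu).symm.trans (h.2 u hu)⟩,
              fun h => ⟨hst.1.trans h.1, fun u hu => (hst.2 u hu).trans (h.2 u hu)⟩⟩
          simp only [b, hk, if_true, this]
        · by_cases h : signalProb q (fun θ t => θ = false ∧ SameInfo G σ a v s t) ≤
            signalProb q (fun θ t => θ = true ∧ SameInfo G σ a v s t)
          · have e : b v s = true := by simp only [b, hk, if_true, h, decide_true]
            rw [e]
            exact h
          · have e : b v s = false := by simp only [b, hk, if_true, h, decide_false]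
            rw [e]
            exact (not_le.mp h).le
      · have e : b v = a v := by
          funext s
          simp [b, hk]
        rw [e]
        exact ha v (by omega)
  obtain ⟨a, ha⟩ := key n
  exact ⟨a, ⟨fun v => (ha v (σ v).2).1, fun v => (ha v (σ v).2).2⟩⟩

end

/-! The complement of the random graph is so sparse that, for suitable constants `N` and `m` with
`m` of order `N ^ 2`, a first moment bound excludes `N` vertices spanning `m` non-edges
(`ComplLocallySparse`). Hence a set in which every vertex has at most `k` earlier neighbours inside
the set has fewer than `N` elements. This already bounds forests and the vertices with fewer than
two earlier neighbours.

For herding, consider a triangle decided in the order `u`, `v`, `w`. Agent `w` could copy `u` when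
`u` and `v` agree and follow its own signal otherwise, so disagreement of `u` and `v` forces a
proportional drop of the error probability from `u` to `w` (`mul_signalProb_ne_le`). If `v` uses its
signal, it disagrees with `u` with conditional probability at least `1 - q`. Well-chosen triangles
through all but boundedly many `v` give drops that cover each error level boundedly often
(`ComplLocallySparse.sum_le`). So the expected number of agents that use their signals is at most a
constant `C`, for every order.

By Markov's inequality, at most `K` agents use their signals, outside an event of probability less
than `q - 1 / 2`. Their signals determine all actions, so such a history has probability at least `η
= (1 / 2) * (1 - q) ^ K` even jointly with the opposite state. Only boundedly many agents use their
signals with probability at least `η`, and almost all agents see all of these and therefore know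
every likely history. When such an agent ignores its signal and acts `true`, the history favours
`true`; this limits how often a first action `false` is reversed when the state is `false`
(`signalProb_exists_reversal_le`). Thus some likely history starts with `false` and is never
reversed by these agents, and it also occurs with probability at least `η` when the state is `true`:
a wrong herd (`le_signalProb_wrongHerd`). This keeps the learning quality away from one. -/

noncomputable section

/-! ### First moment bounds for non-edges of the random graph -/

open MeasureTheory unitInterval in
/-- In a binomial random graph, a set of `m` pairs contains no edge with probability at most
`(1 - p) ^ m`. -/
theorem binomialRandom_real_forall_notMem_edgeSet_le {V : Type*} [Finite V] (p : unitInterval)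
    (F : Finset (Sym2 V)) (hF : ∀ e ∈ F, ¬ e.IsDiag) :
    (SimpleGraph.binomialRandom V p).real {G | ∀ e ∈ F, e ∉ G.edgeSet} ≤
      (1 - (p : ℝ)) ^ F.card := by
  have h : SimpleGraph.binomialRandom V p {G | ∀ e ∈ F, e ∉ G.edgeSet} ≤
      ((toNNReal (σ p) ^ F.card : NNReal) : ENNReal) := by
    rw [SimpleGraph.binomialRandom_apply]
    refine (measure_mono (t := Set.pi (F : Set (Sym2 V)) fun _ => {False}) ?_).trans ?_
    · rintro _ ⟨G, hG, rfl⟩ e he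
      simpa using hG e he
    · rw [Measure.infinitePi_pi _ (fun _ _ => MeasurableSet.of_discrete)]
      rw [ENNReal.coe_pow, ← Finset.prod_const]
      refine (Finset.prod_congr rfl fun e he => ?_).le
      simp [hF e he]
  have h2 := ENNReal.toReal_mono ENNReal.coe_ne_top h
  simpa [measureReal_def] using h2

/-- Union bound over families of sets of pairs of equal size. -/
theorem binomialRandom_real_exists_forall_notMem_edgeSet_le {V : Type*} [Finite V]
    (p : unitInterval) (m : ℕ) (𝓕 : Finset (Finset (Sym2 V)))
    (h𝓕 : ∀ F ∈ 𝓕, F.card = m ∧ ∀ e ∈ F, ¬ e.IsDiag) :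
    (SimpleGraph.binomialRandom V p).real {G | ∃ F ∈ 𝓕, ∀ e ∈ F, e ∉ G.edgeSet} ≤
      𝓕.card * (1 - (p : ℝ)) ^ m := by
  have : {G : SimpleGraph V | ∃ F ∈ 𝓕, ∀ e ∈ F, e ∉ G.edgeSet} =
      ⋃ F ∈ 𝓕, {G | ∀ e ∈ F, e ∉ G.edgeSet} := by
    ext G; simp
  rw [this]
  refine (MeasureTheory.measureReal_biUnion_finset_le _ _).trans ?_
  rw [← nsmul_eq_mul]
  refine Finset.sum_le_card_nsmul _ _ _ fun F hF => ?_
  have := binomialRandom_real_forall_notMem_edgeSet_le p F (h𝓕 F hF).2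
  rwa [(h𝓕 F hF).1] at this

/-- Every `m` pairs inside a set of `N` vertices contain an edge. -/
def ComplLocallySparse {V : Type*} (G : SimpleGraph V) (N m : ℕ) : Prop :=
  ∀ A : Finset V, A.card = N → ∀ F : Finset (Sym2 V),
    (∀ e ∈ F, ¬ e.IsDiag ∧ ∀ x ∈ e, x ∈ A) → F.card = m → ∃ e ∈ F, e ∈ G.edgeSet

/-- Among any `d` vertices other than `v` there is a neighbour of `v`. -/
def ComplDegreeLT {V : Type*} (G : SimpleGraph V) (d : ℕ) : Prop :=
  ∀ v : V, ∀ S : Finset V, v ∉ S → S.card = d → ∃ u ∈ S, G.Adj v u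

/-- Union bound over the vertex set and the `m` pairs inside it. The binomial coefficient of `N + 1`
arises because `A.sym2` also contains the diagonal pairs. -/
theorem binomialRandom_real_not_complLocallySparse_le (n N m : ℕ) (p : unitInterval) :
    (SimpleGraph.binomialRandom (Fin n) p).real {G | ¬ ComplLocallySparse G N m} ≤
      (n : ℝ) ^ N * ((N + 1).choose 2).choose m * (1 - (p : ℝ)) ^ m := by
  classical
  let 𝓕 : Finset (Finset (Sym2 (Fin n))) := (Finset.powersetCard N Finset.univ).biUnion fun A =>
    (A.sym2.powersetCard m).filter fun F => ∀ e ∈ F, ¬ e.IsDiag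
  have hc : (𝓕.card : ℝ) ≤ (n : ℝ) ^ N * ((N + 1).choose 2).choose m := by
    have : 𝓕.card ≤ n ^ N * ((N + 1).choose 2).choose m := by
      refine (Finset.card_biUnion_le_card_mul _ _ (((N + 1).choose 2).choose m) fun A hA => ?_).trans
        ?_
      · refine (Finset.card_filter_le _ _).trans ?_
        rw [Finset.card_powersetCard, Finset.card_sym2, (Finset.mem_powersetCard.mp hA).2]
      · rw [Finset.card_powersetCard, Finset.card_univ, Fintype.card_fin]
        exact Nat.mul_le_mul_right _ (Nat.choose_le_pow _ _)
    exact_mod_cast this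
  have hp : 0 ≤ 1 - (p : ℝ) := sub_nonneg.mpr p.2.2
  refine le_trans ?_ (mul_le_mul_of_nonneg_right hc (pow_nonneg hp m))
  refine le_trans (MeasureTheory.measureReal_mono ?_ (MeasureTheory.measure_ne_top _ _))
    (binomialRandom_real_exists_forall_notMem_edgeSet_le p m 𝓕 ?_)
  · intro G hG
    simp only [Set.mem_ofPred_eq, ComplLocallySparse] at hG
    push Not at hG
    obtain ⟨A, hA, F, hF, hFm, h⟩ := hG
    refine ⟨F, ?_, h⟩
    simp only [𝓕, Finset.mem_biUnion, Finset.mem_filter, Finset.mem_powersetCard]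
    exact ⟨A, ⟨Finset.subset_univ _, hA⟩,
      ⟨fun e he => Finset.mem_sym2_iff.mpr (hF e he).2, hFm⟩, fun e he => (hF e he).1⟩
  · intro F hF
    simp only [𝓕, Finset.mem_biUnion, Finset.mem_filter, Finset.mem_powersetCard] at hF
    obtain ⟨A, -, h1, h2⟩ := hF
    exact ⟨h1.2, h2⟩

theorem binomialRandom_real_not_complDegreeLT_le (n d : ℕ) (p : unitInterval) :
    (SimpleGraph.binomialRandom (Fin n) p).real {G | ¬ ComplDegreeLT G d} ≤
      (n : ℝ) * 2 ^ n * (1 - (p : ℝ)) ^ d := by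
  classical
  let 𝓕 : Finset (Finset (Sym2 (Fin n))) := Finset.univ.biUnion fun v =>
    ((Finset.univ.erase v).powersetCard d).image fun S => S.image fun u => s(v, u)
  have hc : (𝓕.card : ℝ) ≤ (n : ℝ) * 2 ^ n := by
    have : 𝓕.card ≤ n * 2 ^ n := by
      refine (Finset.card_biUnion_le_card_mul _ _ (2 ^ n) fun v _ => ?_).trans ?_
      · refine Finset.card_image_le.trans ?_
        refine (Finset.card_le_univ _).trans ?_
        simp
      · simp
    exact_mod_cast this
  have hp : 0 ≤ 1 - (p : ℝ) := sub_nonneg.mpr p.2.2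
  refine le_trans ?_ (mul_le_mul_of_nonneg_right hc (pow_nonneg hp d))
  refine le_trans (MeasureTheory.measureReal_mono ?_ (MeasureTheory.measure_ne_top _ _))
    (binomialRandom_real_exists_forall_notMem_edgeSet_le p d 𝓕 ?_)
  · intro G hG
    simp only [Set.mem_ofPred_eq, ComplDegreeLT] at hG
    push Not at hG
    obtain ⟨v, S, hv, hS, h⟩ := hG
    refine ⟨S.image fun u => s(v, u), ?_, ?_⟩
    · simp only [𝓕, Finset.mem_biUnion, Finset.mem_image, Finset.mem_powersetCard]
      exact ⟨v, Finset.mem_univ _, S, ⟨fun u hu => Finset.mem_erase.mpr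
        ⟨fun e => hv (e ▸ hu), Finset.mem_univ _⟩, hS⟩, rfl⟩
    · intro e he
      obtain ⟨u, hu, rfl⟩ := Finset.mem_image.mp he
      exact h u hu
  · intro F hF
    simp only [𝓕, Finset.mem_biUnion, Finset.mem_image, Finset.mem_powersetCard] at hF
    obtain ⟨v, -, S, ⟨hS, hSd⟩, rfl⟩ := hF
    refine ⟨?_, fun e he => ?_⟩
    · rw [Finset.card_image_of_injective _ (fun x y hxy => Sym2.congr_right.mp hxy), hSd]
    · obtain ⟨u, hu, rfl⟩ := Finset.mem_image.mp he
      have := (Finset.mem_erase.mp (hS hu)).1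
      simpa using this.symm

/-- A sequence of events has probability tending to one if the complements are contained in events
of vanishing probability. -/
theorem tendsto_binomialRandom_real_one {p : ℕ → unitInterval}
    {S B : ∀ n : ℕ, Set (SimpleGraph (Fin n))}
    (hB : Tendsto (fun n => (SimpleGraph.binomialRandom (Fin n) (p n)).real (B n)) atTop (𝓝 0))
    (h : ∀ᶠ n in atTop, (S n)ᶜ ⊆ B n) :
    Tendsto (fun n => (SimpleGraph.binomialRandom (Fin n) (p n)).real (S n)) atTop (𝓝 1) := by
  have h1 : Tendsto (fun n => 1 - (SimpleGraph.binomialRandom (Fin n) (p n)).real (B n)) atTop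
      (𝓝 1) := by simpa using hB.const_sub 1
  refine tendsto_of_tendsto_of_tendsto_of_le_of_le' h1 tendsto_const_nhds ?_
    (Eventually.of_forall fun n => MeasureTheory.measureReal_le_one)
  filter_upwards [h] with n hn
  have h2 := MeasureTheory.measureReal_mono (μ := SimpleGraph.binomialRandom (Fin n) (p n)) hn
    (MeasureTheory.measure_ne_top _ _)
  have h3 := MeasureTheory.measureReal_union_le
    (μ := SimpleGraph.binomialRandom (Fin n) (p n)) (S n) (S n)ᶜ
  rw [Set.union_compl_self, MeasureTheory.probReal_univ] at h3
  linarith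

/-- There are at most `n ^ N` vertex sets, and `m` given pairs are all missing with probability of
order at most `n ^ ((ε - 1) * m)`; `hNm` makes the total exponent negative. -/
theorem tendsto_real_not_complLocallySparse {ε : ℝ} {p : ℕ → unitInterval}
    (hp : (fun n : ℕ => 1 - (p n : ℝ)) =O[atTop] fun n : ℕ => (n : ℝ) ^ ε / (n : ℝ))
    {N m : ℕ} (hNm : (N : ℝ) < (1 - ε) * m) :
    Tendsto (fun n => (SimpleGraph.binomialRandom (Fin n) (p n)).real
      {G | ¬ ComplLocallySparse G N m}) atTop (𝓝 0) := by
  obtain ⟨C, hC⟩ := hp.bound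
  have hlim : Tendsto (fun n : ℕ => (((N + 1).choose 2).choose m * C ^ m : ℝ) *
      (n : ℝ) ^ (-((1 - ε) * m - N))) atTop (𝓝 0) := by
    have := (tendsto_rpow_neg_atTop (y := (1 - ε) * m - N) (by linarith)).comp
      (tendsto_natCast_atTop_atTop (R := ℝ))
    simpa using this.const_mul (((N + 1).choose 2).choose m * C ^ m : ℝ)
  refine squeeze_zero' (Eventually.of_forall fun n => MeasureTheory.measureReal_nonneg) ?_ hlim
  filter_upwards [hC, eventually_gt_atTop 0] with n hn hn0
  have hn0' : (0 : ℝ) < n := by exact_mod_cast hn0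
  refine (binomialRandom_real_not_complLocallySparse_le n N m (p n)).trans ?_
  have h0 : 0 ≤ 1 - (p n : ℝ) := sub_nonneg.mpr (p n).2.2
  have h1 : 1 - (p n : ℝ) ≤ C * (n : ℝ) ^ (ε - 1) := by
    rw [Real.norm_of_nonneg h0, Real.norm_of_nonneg (by positivity)] at hn
    rwa [Real.rpow_sub hn0', Real.rpow_one]
  have h2 : (1 - (p n : ℝ)) ^ m ≤ C ^ m * (n : ℝ) ^ ((ε - 1) * m) := by
    refine (pow_le_pow_left₀ h0 h1 m).trans_eq ?_
    rw [mul_pow, ← Real.rpow_mul_natCast hn0'.le]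
  have h3 : (n : ℝ) ^ (-((1 - ε) * m - N)) = (n : ℝ) ^ N * (n : ℝ) ^ ((ε - 1) * m) := by
    rw [← Real.rpow_natCast, ← Real.rpow_add hn0']
    congr 1; ring
  rw [h3]
  calc _ ≤ (n : ℝ) ^ N * ((N + 1).choose 2).choose m * (C ^ m * (n : ℝ) ^ ((ε - 1) * m)) := by
        gcongr
    _ = _ := by ring

theorem tendsto_real_not_complDegreeLT {ε : ℝ} (hε' : ε < 1) {p : ℕ → unitInterval}
    (hp : (fun n : ℕ => 1 - (p n : ℝ)) =O[atTop] fun n : ℕ => (n : ℝ) ^ ε / (n : ℝ))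
    {β : ℝ} (hβ : 0 < β) :
    Tendsto (fun n => (SimpleGraph.binomialRandom (Fin n) (p n)).real
      {G | ¬ ComplDegreeLT G ⌈β * n⌉₊}) atTop (𝓝 0) := by
  have hp0 : Tendsto (fun n : ℕ => 1 - (p n : ℝ)) atTop (𝓝 0) := by
    refine hp.trans_tendsto ?_
    have := (tendsto_rpow_neg_atTop (y := 1 - ε) (by linarith)).comp
      (tendsto_natCast_atTop_atTop (R := ℝ))
    refine this.congr' ?_
    filter_upwards [eventually_gt_atTop 0] with n hn0
    have hn0' : (0 : ℝ) < n := by exact_mod_cast hn0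
    simp [Real.rpow_sub hn0']
  -- Chosen so that `δ ^ (β * n) = (1 / 4) ^ n`, which beats the `2 ^ n` vertex sets of the union
  -- bound. Only `1 - p n → 0` is needed here.
  set δ : ℝ := (1 / 4) ^ (1 / β) with hδ
  have hδ0 : 0 < δ := by positivity
  have hδ1 : δ ≤ 1 := Real.rpow_le_one (by norm_num) (by norm_num) (by positivity)
  have hlim : Tendsto (fun n : ℕ => (n : ℝ) * (1 / 2 : ℝ) ^ n) atTop (𝓝 0) :=
    tendsto_self_mul_const_pow_of_lt_one (by norm_num) (by norm_num)
  refine squeeze_zero' (Eventually.of_forall fun n => MeasureTheory.measureReal_nonneg) ?_ hlim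
  filter_upwards [hp0.eventually (ge_mem_nhds hδ0)] with n hn
  refine (binomialRandom_real_not_complDegreeLT_le n _ (p n)).trans ?_
  have h0 : 0 ≤ 1 - (p n : ℝ) := sub_nonneg.mpr (p n).2.2
  have h1 : (1 - (p n : ℝ)) ^ ⌈β * n⌉₊ ≤ (1 / 4) ^ n := by
    calc (1 - (p n : ℝ)) ^ ⌈β * n⌉₊ ≤ δ ^ ⌈β * n⌉₊ := pow_le_pow_left₀ h0 hn _
      _ = δ ^ ((⌈β * n⌉₊ : ℕ) : ℝ) := (Real.rpow_natCast _ _).symm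
      _ ≤ δ ^ (β * n) := Real.rpow_le_rpow_of_exponent_ge hδ0 hδ1 (Nat.le_ceil _)
      _ = (1 / 4) ^ n := by
        rw [hδ, ← Real.rpow_mul (by norm_num), ← mul_assoc, one_div_mul_cancel hβ.ne', one_mul,
          Real.rpow_natCast]
  calc _ ≤ (n : ℝ) * 2 ^ n * (1 / 4) ^ n := by gcongr
    _ = _ := by rw [mul_assoc, ← mul_pow]; norm_num

/-! ### Deterministic consequences of a locally sparse complement -/

/-- In a graph with locally sparse complement, sets in which every vertex has at most `k` earlier
neighbours are small. -/
theorem ComplLocallySparse.card_lt_of_degenerate {V : Type*} {G : SimpleGraph V} {N m k : ℕ}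
    (hG : ComplLocallySparse G N m) (hm : m + k * N ≤ N.choose 2) {f : V → ℕ}
    (hf : Function.Injective f) (A : Finset V)
    (hA : ∀ v ∈ A, {u | u ∈ A ∧ G.Adj u v ∧ f u < f v}.ncard ≤ k) : A.card < N := by
  classical
  by_contra! hN
  obtain ⟨A', hA', rfl⟩ := Finset.exists_subset_card_eq hN
  let P := A'.offDiag.image (fun x => s(x.1, x.2))
  have hP : P.card = A'.card.choose 2 := Sym2.card_image_offDiag A'
  let E := P.filter (· ∈ G.edgeSet)
  let F := P.filter (· ∉ G.edgeSet)
  have hEF : E.card + F.card = P.card := Finset.card_filter_add_card_filter_not _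
  -- Each edge is charged to its endpoint with the larger value of `f`. At least `m` of the pairs in
  -- `A'` then remain as non-edges.
  have hE : E.card ≤ A'.card * k := by
    have hsub : E ⊆ A'.biUnion fun v =>
        (A'.filter fun u => G.Adj u v ∧ f u < f v).image fun u => s(u, v) := by
      intro e he
      obtain ⟨he, hadj⟩ := Finset.mem_filter.mp he
      obtain ⟨⟨u, v⟩, huv, rfl⟩ := Finset.mem_image.mp he
      obtain ⟨hu, hv, hne⟩ := Finset.mem_offDiag.mp huv
      simp only [SimpleGraph.mem_edgeSet] at hadj
      simp only [Finset.mem_biUnion, Finset.mem_image, Finset.mem_filter]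
      rcases lt_or_gt_of_ne (fun h => hne (hf h) : f u ≠ f v) with h | h
      · exact ⟨v, hv, u, ⟨hu, hadj, h⟩, rfl⟩
      · exact ⟨u, hu, v, ⟨hv, hadj.symm, h⟩, Sym2.eq_swap⟩
    refine (Finset.card_le_card hsub).trans (Finset.card_biUnion_le_card_mul _ _ _ fun v hv => ?_)
    refine Finset.card_image_le.trans (le_trans ?_ (hA v (hA' hv)))
    rw [← Set.ncard_coe_finset]
    refine Set.ncard_le_ncard (fun u hu => ?_) (A.finite_toSet.subset fun u hu => hu.1)
    obtain ⟨hu, h⟩ := Finset.mem_filter.mp (Finset.mem_coe.mp hu)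
    exact ⟨hA' hu, h⟩
  have hF : m ≤ F.card := by rw [mul_comm] at hE; omega
  obtain ⟨F', hF', hF'm⟩ := Finset.exists_subset_card_eq hF
  have hF'A : ∀ e ∈ F', ¬ e.IsDiag ∧ ∀ x ∈ e, x ∈ A' := by
    intro e he
    obtain ⟨⟨u, v⟩, huv, rfl⟩ := Finset.mem_image.mp (Finset.mem_filter.mp (hF' he)).1
    obtain ⟨hu, hv, hne⟩ := Finset.mem_offDiag.mp huv
    refine ⟨by simpa using hne, fun x hx => ?_⟩
    rcases Sym2.mem_iff.mp hx with rfl | rfl <;> assumption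
  obtain ⟨e, he, hadj⟩ := hG A' rfl F' hF'A hF'm
  exact (Finset.mem_filter.mp (hF' he)).2 hadj

/-- The pairs between `U` and `W` are `k * k` pairs inside a set of `2 * k` vertices. -/
theorem ComplLocallySparse.exists_adj {V : Type*} {G : SimpleGraph V} {k : ℕ}
    (hG : ComplLocallySparse G (2 * k) (k * k)) {U W : Finset V} (hUW : Disjoint U W)
    (hU : U.card = k) (hW : W.card = k) : ∃ u ∈ U, ∃ w ∈ W, G.Adj u w := by
  classical
  have hsub : ∀ e ∈ (U ×ˢ W).image fun x => s(x.1, x.2), ¬ e.IsDiag ∧ ∀ x ∈ e, x ∈ U ∪ W := by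
    intro e he
    obtain ⟨⟨u, w⟩, huw, rfl⟩ := Finset.mem_image.mp he
    obtain ⟨hu, hw⟩ := Finset.mem_product.mp huw
    refine ⟨?_, fun x hx => ?_⟩
    · simpa using fun h : u = w => Finset.disjoint_left.mp hUW hu (h ▸ hw)
    · rcases Sym2.mem_iff.mp hx with rfl | rfl
      · exact Finset.mem_union_left _ hu
      · exact Finset.mem_union_right _ hw
  have hcard : ((U ×ˢ W).image fun x => s(x.1, x.2)).card = k * k := by
    rw [Finset.card_image_of_injOn, Finset.card_product, hU, hW]
    rintro ⟨u, w⟩ h ⟨u', w'⟩ h' heq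
    obtain ⟨hu, hw⟩ := Finset.mem_product.mp (Finset.mem_coe.mp h)
    obtain ⟨hu', hw'⟩ := Finset.mem_product.mp (Finset.mem_coe.mp h')
    rcases Sym2.eq_iff.mp heq with ⟨h1, h2⟩ | ⟨h1, h2⟩
    · exact Prod.ext h1 h2
    · exact (Finset.disjoint_left.mp hUW hu ((show u = w' from h1) ▸ hw')).elim
  obtain ⟨e, he, hadj⟩ := hG (U ∪ W) (by rw [Finset.card_union_of_disjoint hUW]; omega) _ hsub
    hcard
  obtain ⟨⟨u, w⟩, huw, rfl⟩ := Finset.mem_image.mp he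
  obtain ⟨hu, hw⟩ := Finset.mem_product.mp huw
  exact ⟨u, hu, w, hw, hadj⟩

/-- A forest is bipartite, and each colour class is independent, hence has fewer than `N` vertices.
-/
theorem ComplLocallySparse.card_lt_of_isAcyclic {n : ℕ} {G : SimpleGraph (Fin n)} {N m : ℕ}
    (hG : ComplLocallySparse G N m) (hm : m ≤ N.choose 2) (S : Finset (Fin n))
    (hS : (G.induce (S : Set (Fin n))).IsAcyclic) : S.card < 2 * N := by
  classical
  obtain ⟨col⟩ := hS.colorable_two
  have key : ∀ i : Fin 2, (S.filter fun v => ∃ h : v ∈ S, col ⟨v, h⟩ = i).card < N := by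
    intro i
    refine hG.card_lt_of_degenerate (k := 0) (by omega) Fin.val_injective _ fun v hv => ?_
    obtain ⟨-, hv, hvi⟩ := Finset.mem_filter.mp hv
    refine (Set.ncard_eq_zero (Set.toFinite _)).mpr ?_ |>.le
    refine Set.eq_empty_of_forall_notMem fun u hu' => ?_
    obtain ⟨hu, hadj, -⟩ := hu'
    obtain ⟨-, hu, hui⟩ := Finset.mem_filter.mp hu
    have h := col.valid (v := ⟨u, hu⟩) (w := ⟨v, hv⟩) hadj
    exact h (hui.trans hvi.symm)
  have hsub : S ⊆ (S.filter fun v => ∃ h : v ∈ S, col ⟨v, h⟩ = 0) ∪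
      S.filter fun v => ∃ h : v ∈ S, col ⟨v, h⟩ = 1 := by
    intro v hv
    have h : ∀ i : Fin 2, i = 0 ∨ i = 1 := by decide
    rcases h (col ⟨v, hv⟩) with h | h
    · exact Finset.mem_union_left _ (Finset.mem_filter.mpr ⟨hv, hv, h⟩)
    · exact Finset.mem_union_right _ (Finset.mem_filter.mpr ⟨hv, hv, h⟩)
  have := (Finset.card_le_card hsub).trans (Finset.card_union_le _ _)
  have h0 := key 0
  have h1 := key 1
  omega

/-- The neighbours of `v` that decide after `v`. -/
def laterNeighbors {n : ℕ} (G : SimpleGraph (Fin n)) (σ : Equiv.Perm (Fin n)) (v : Fin n) :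
    Finset (Fin n) :=
  open Classical in
  Finset.univ.filter fun u => G.Adj v u ∧ σ v < σ u

theorem mem_earlierNeighbors {n : ℕ} {G : SimpleGraph (Fin n)} {σ : Equiv.Perm (Fin n)}
    {u v : Fin n} : u ∈ earlierNeighbors G σ v ↔ G.Adj u v ∧ σ u < σ v := by
  simp [earlierNeighbors]

theorem mem_laterNeighbors {n : ℕ} {G : SimpleGraph (Fin n)} {σ : Equiv.Perm (Fin n)}
    {u v : Fin n} : u ∈ laterNeighbors G σ v ↔ G.Adj v u ∧ σ v < σ u := by
  simp [laterNeighbors]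

theorem ComplLocallySparse.card_lt_of_earlierNeighbors {n : ℕ} {G : SimpleGraph (Fin n)}
    {N m k : ℕ} (hG : ComplLocallySparse G N m) (hm : m + k * N ≤ N.choose 2)
    (σ : Equiv.Perm (Fin n)) (A : Finset (Fin n))
    (hA : ∀ v ∈ A, ((earlierNeighbors G σ v).filter (· ∈ A)).card ≤ k) : A.card < N := by
  refine hG.card_lt_of_degenerate hm (f := fun v => (σ v : ℕ))
    (Fin.val_injective.comp σ.injective) A fun v hv => le_trans (le_of_eq ?_) (hA v hv)
  rw [← Set.ncard_coe_finset]
  congr 1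
  ext u
  simp only [Finset.coe_filter, mem_earlierNeighbors, Set.mem_ofPred_eq, Fin.val_fin_lt]
  tauto

theorem ComplLocallySparse.card_lt_of_laterNeighbors {n : ℕ} {G : SimpleGraph (Fin n)}
    {N m k : ℕ} (hG : ComplLocallySparse G N m) (hm : m + k * N ≤ N.choose 2)
    (σ : Equiv.Perm (Fin n)) (A : Finset (Fin n))
    (hA : ∀ v ∈ A, ((laterNeighbors G σ v).filter (· ∈ A)).card ≤ k) : A.card < N := by
  -- Later neighbours are earlier neighbours in the reversed order.
  refine hG.card_lt_of_degenerate hm (f := fun v => ((σ v).rev : ℕ))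
    (Fin.val_injective.comp (Fin.rev_injective.comp σ.injective)) A
    fun v hv => le_trans (le_of_eq ?_) (hA v hv)
  rw [← Set.ncard_coe_finset]
  congr 1
  ext u
  simp only [Finset.coe_filter, mem_laterNeighbors, Set.mem_ofPred_eq, Fin.val_fin_lt,
    Fin.rev_lt_rev, G.adj_comm u v]
  tauto

/-! ### Summation over triangles by counting levels -/

/-- A finite set with at least `k` elements has `k` elements at which `e` is smallest. -/
theorem Finset.exists_subset_card_eq_forall_le {α : Type*} (S : Finset α) (e : α → ℝ) (k : ℕ)
    (hk : k ≤ S.card) : ∃ U ⊆ S, U.card = k ∧ ∀ u ∈ U, ∀ w ∈ S, w ∉ U → e u ≤ e w := by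
  classical
  induction k with
  | zero => exact ⟨∅, by simp, rfl, by simp⟩
  | succ k ih =>
    obtain ⟨U, hU, hUk, h⟩ := ih (by omega)
    have hne : (S \ U).Nonempty := by
      rw [← Finset.card_pos, Finset.card_sdiff_of_subset hU]; omega
    obtain ⟨x, hx, hmin⟩ := Finset.exists_min_image (S \ U) e hne
    obtain ⟨hxS, hxU⟩ := Finset.mem_sdiff.mp hx
    refine ⟨insert x U, Finset.insert_subset hxS hU, by rw [Finset.card_insert_of_notMem hxU, hUk],
      fun u hu w hw hwU => ?_⟩
    rw [Finset.mem_insert, not_or] at hwU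
    rcases Finset.mem_insert.mp hu with rfl | hu
    · exact hmin w (Finset.mem_sdiff.mpr ⟨hw, hwU.2⟩)
    · exact h u hu w hw hwU.2

open MeasureTheory in
/-- If every level lies in at most `M` of the intervals `[a v, b v) ⊆ [0, 1]`, then their total
length is at most `M`. -/
theorem Finset.sum_sub_le_of_card_filter_le {ι : Type*} (R : Finset ι) (a b : ι → ℝ) (M : ℕ)
    (ha : ∀ v ∈ R, 0 ≤ a v) (hb : ∀ v ∈ R, b v ≤ 1)
    (h : ∀ x : ℝ, (R.filter fun v => a v ≤ x ∧ x < b v).card ≤ M) :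
    ∑ v ∈ R, (b v - a v) ≤ M := by
  classical
  -- The total length is the integral over `x` of the number of intervals containing `x`. Truncating
  -- negative lengths to zero only enlarges the sum.
  have h1 : ∑ v ∈ R, ENNReal.ofReal (b v - a v) ≤ M := by
    calc ∑ v ∈ R, ENNReal.ofReal (b v - a v)
        = ∑ v ∈ R, ∫⁻ x : ℝ, (Set.Ico (a v) (b v)).indicator 1 x := by
          refine Finset.sum_congr rfl fun v _ => ?_
          rw [lintegral_indicator_one measurableSet_Ico, Real.volume_Ico]
      _ = ∫⁻ x : ℝ, ∑ v ∈ R, (Set.Ico (a v) (b v)).indicator 1 x :=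
          (lintegral_finsetSum _ fun v _ => measurable_one.indicator measurableSet_Ico).symm
      _ ≤ ∫⁻ x : ℝ, (Set.Icc (0 : ℝ) 1).indicator (fun _ => (M : ENNReal)) x := by
          refine lintegral_mono fun x => ?_
          by_cases hx : x ∈ Set.Icc (0 : ℝ) 1
          · rw [Set.indicator_of_mem hx]
            have : ∑ v ∈ R, (Set.Ico (a v) (b v)).indicator (1 : ℝ → ENNReal) x =
                ((R.filter fun v => a v ≤ x ∧ x < b v).card : ENNReal) := by
              rw [Finset.card_filter, Nat.cast_sum]
              refine Finset.sum_congr rfl fun v _ => ?_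
              simp [Set.indicator_apply]
            rw [this]
            exact Nat.cast_le.mpr (h x)
          · rw [Set.indicator_of_notMem hx]
            refine (Finset.sum_eq_zero fun v hv => Set.indicator_of_notMem (fun hxv => hx ?_) _).le
            exact ⟨(ha v hv).trans hxv.1, (hxv.2.trans_le (hb v hv)).le⟩
      _ = M := by
          rw [lintegral_indicator measurableSet_Icc]
          simp
  calc ∑ v ∈ R, (b v - a v) ≤ ∑ v ∈ R, (ENNReal.ofReal (b v - a v)).toReal :=
        Finset.sum_le_sum fun v _ => by
          rw [ENNReal.toReal_ofReal']
          exact le_max_left _ _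
    _ = (∑ v ∈ R, ENNReal.ofReal (b v - a v)).toReal :=
        (ENNReal.toReal_sum fun v _ => ENNReal.ofReal_ne_top).symm
    _ ≤ M := by
        have := ENNReal.toReal_mono (ENNReal.natCast_ne_top M) h1
        simpa using this

/-- In a graph with locally sparse complement, quantities `f v` that are controlled by the
decrement of `e` over every triangle with middle vertex `v` have bounded sum. -/
theorem ComplLocallySparse.sum_le {n : ℕ} {G : SimpleGraph (Fin n)} {N m k : ℕ}
    (hG : ComplLocallySparse G N m) (hm : m + k * N ≤ N.choose 2)
    (hG' : ComplLocallySparse G (2 * (k + 1)) ((k + 1) * (k + 1)))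
    (σ : Equiv.Perm (Fin n)) (e f : Fin n → ℝ) {c : ℝ} (hc : 0 ≤ c)
    (he : ∀ v, 0 ≤ e v) (he' : ∀ v, e v ≤ 1) (hf' : ∀ v, f v ≤ 1)
    (htri : ∀ u v w, G.Adj u v → G.Adj v w → G.Adj u w → σ u < σ v → σ v < σ w →
      f v ≤ c * (e u - e w)) :
    ∑ v, f v ≤ 2 * N + c * (2 * N) := by
  classical
  let X₁ := Finset.univ.filter fun v => (earlierNeighbors G σ v).card ≤ k
  let X₂ := Finset.univ.filter fun v => (laterNeighbors G σ v).card ≤ k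
  have hX₁ : X₁.card < N := hG.card_lt_of_earlierNeighbors hm σ X₁ fun v hv =>
    (Finset.card_filter_le _ _).trans (Finset.mem_filter.mp hv).2
  have hX₂ : X₂.card < N := hG.card_lt_of_laterNeighbors hm σ X₂ fun v hv =>
    (Finset.card_filter_le _ _).trans (Finset.mem_filter.mp hv).2
  let R := (X₁ ∪ X₂)ᶜ
  have hR : ∀ v ∈ R, k + 1 ≤ (earlierNeighbors G σ v).card ∧
      k + 1 ≤ (laterNeighbors G σ v).card := by
    intro v hv
    simp only [R, X₁, X₂, Finset.mem_compl, Finset.mem_union, Finset.mem_filter, Finset.mem_univ,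
      true_and, not_or, not_le] at hv
    exact hv
  -- The ends of the triangle are an adjacent pair between the `k + 1` earlier neighbours of
  -- smallest `e` and the `k + 1` later neighbours of largest `e`. So at most `k` earlier neighbours
  -- lie strictly below `e u`, and at most `k` later ones strictly above `e w`.
  have hsel : ∀ v, ∃ u w, v ∈ R → f v ≤ c * (e u - e w) ∧
      (∀ x, x < e u → ((earlierNeighbors G σ v).filter fun y => e y ≤ x).card ≤ k) ∧
      (∀ x, e w ≤ x → ((laterNeighbors G σ v).filter fun y => x < e y).card ≤ k) := by
    intro v
    by_cases hv : v ∈ R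
    swap
    · exact ⟨v, v, fun h => absurd h hv⟩
    obtain ⟨U, hU, hUk, hUe⟩ := (earlierNeighbors G σ v).exists_subset_card_eq_forall_le e (k + 1)
      (hR v hv).1
    obtain ⟨W, hW, hWk, hWe⟩ := (laterNeighbors G σ v).exists_subset_card_eq_forall_le
      (fun y => - e y) (k + 1) (hR v hv).2
    have hUW : Disjoint U W := by
      refine Finset.disjoint_left.mpr fun x hx hx' => ?_
      have h1 := (mem_earlierNeighbors.mp (hU hx)).2
      have h2 := (mem_laterNeighbors.mp (hW hx')).2
      exact lt_asymm h1 h2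
    obtain ⟨u, hu, w, hw, huw⟩ := hG'.exists_adj hUW hUk hWk
    obtain ⟨huv, hσu⟩ := mem_earlierNeighbors.mp (hU hu)
    obtain ⟨hvw, hσw⟩ := mem_laterNeighbors.mp (hW hw)
    refine ⟨u, w, fun _ => ⟨htri u v w huv hvw huw hσu hσw, fun x hx => ?_, fun x hx => ?_⟩⟩
    · have hsub : ((earlierNeighbors G σ v).filter fun y => e y ≤ x) ⊆ U.erase u := by
        intro y hy
        obtain ⟨hy, hyx⟩ := Finset.mem_filter.mp hy
        have hyu : e y < e u := hyx.trans_lt hx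
        refine Finset.mem_erase.mpr ⟨fun h => by simp [h] at hyu, ?_⟩
        by_contra hyU
        exact absurd (hUe u hu y hy hyU) (not_le.mpr hyu)
      have := Finset.card_le_card hsub
      rw [Finset.card_erase_of_mem hu, hUk] at this
      simpa using this
    · have hsub : ((laterNeighbors G σ v).filter fun y => x < e y) ⊆ W.erase w := by
        intro y hy
        obtain ⟨hy, hyx⟩ := Finset.mem_filter.mp hy
        have hyw : e w < e y := hx.trans_lt hyx
        refine Finset.mem_erase.mpr ⟨fun h => by simp [h] at hyw, ?_⟩
        by_contra hyW
        exact absurd (neg_le_neg_iff.mp (hWe w hw y hy hyW)) (not_le.mpr hyw)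
      have := Finset.card_le_card hsub
      rw [Finset.card_erase_of_mem hw, hWk] at this
      simpa using this
  choose u w hsel using hsel
  -- Split the `v` whose interval contains `x` according to `e v ≤ x` or `x < e v`. By the choice of
  -- `u` and `w`, each member of the first class has at most `k` earlier neighbours in the class,
  -- and each member of the second at most `k` later ones.
  have hlevel : ∀ x : ℝ, (R.filter fun v => e (w v) ≤ x ∧ x < e (u v)).card ≤ 2 * N := by
    intro x
    have h1 : ((R.filter fun v => e (w v) ≤ x ∧ x < e (u v)).filter fun v => e v ≤ x).card < N := by
      refine hG.card_lt_of_earlierNeighbors hm σ _ fun v hv => ?_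
      obtain ⟨hv, -⟩ := Finset.mem_filter.mp hv
      obtain ⟨hv, -, hx⟩ := Finset.mem_filter.mp hv
      refine (Finset.card_le_card fun y hy => ?_).trans ((hsel v hv).2.1 x hx)
      obtain ⟨hy, hy'⟩ := Finset.mem_filter.mp hy
      exact Finset.mem_filter.mpr ⟨hy, (Finset.mem_filter.mp hy').2⟩
    have h2 : ((R.filter fun v => e (w v) ≤ x ∧ x < e (u v)).filter fun v => ¬ e v ≤ x).card
        < N := by
      refine hG.card_lt_of_laterNeighbors hm σ _ fun v hv => ?_
      obtain ⟨hv, -⟩ := Finset.mem_filter.mp hv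
      obtain ⟨hv, hx, -⟩ := Finset.mem_filter.mp hv
      refine (Finset.card_le_card fun y hy => ?_).trans ((hsel v hv).2.2 x hx)
      obtain ⟨hy, hy'⟩ := Finset.mem_filter.mp hy
      exact Finset.mem_filter.mpr ⟨hy, not_le.mp (Finset.mem_filter.mp hy').2⟩
    have h3 := Finset.card_filter_add_card_filter_not
      (s := R.filter fun v => e (w v) ≤ x ∧ x < e (u v)) (fun v => e v ≤ x)
    omega
  have hsum := R.sum_sub_le_of_card_filter_le (fun v => e (w v)) (fun v => e (u v)) (2 * N)
    (fun v _ => he _) (fun v _ => he' _) hlevel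
  have hX : ∑ v ∈ X₁ ∪ X₂, f v ≤ 2 * N := by
    calc ∑ v ∈ X₁ ∪ X₂, f v ≤ ∑ v ∈ X₁ ∪ X₂, (1 : ℝ) := Finset.sum_le_sum fun v _ => hf' v
      _ = ((X₁ ∪ X₂).card : ℝ) := by simp
      _ ≤ ((2 * N : ℕ) : ℝ) := by
        have := Finset.card_union_le X₁ X₂
        exact_mod_cast (by omega : (X₁ ∪ X₂).card ≤ 2 * N)
      _ = 2 * N := by push_cast; rfl
  have hRsum : ∑ v ∈ R, f v ≤ c * (2 * N) := by
    calc ∑ v ∈ R, f v ≤ ∑ v ∈ R, c * (e (u v) - e (w v)) :=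
          Finset.sum_le_sum fun v hv => (hsel v hv).1
      _ = c * ∑ v ∈ R, (e (u v) - e (w v)) := (Finset.mul_sum _ _ _).symm
      _ ≤ c * ((2 * N : ℕ) : ℝ) := mul_le_mul_of_nonneg_left hsum hc
      _ = c * (2 * N) := by push_cast; rfl
  rw [← Finset.sum_add_sum_compl (X₁ ∪ X₂)]
  exact add_le_add hX hRsum

/-! ### Signal reversal and probabilities of signal events -/

/-- Reversal of the private signal of `v`. -/
def flipSignal {n : ℕ} (v : Fin n) : Equiv.Perm (Fin n → Bool) :=
  Function.Involutive.toPerm (fun s => Function.update s v (!(s v))) fun s => by simp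

theorem flipSignal_apply {n : ℕ} (v : Fin n) (s : Fin n → Bool) :
    flipSignal v s = Function.update s v (!(s v)) := rfl

theorem flipSignal_self {n : ℕ} (v : Fin n) (s : Fin n → Bool) : flipSignal v s v = !(s v) := by
  simp [flipSignal_apply]

theorem flipSignal_of_ne {n : ℕ} {u v : Fin n} (h : u ≠ v) (s : Fin n → Bool) :
    flipSignal v s u = s u := by
  simp [flipSignal_apply, h]

theorem flipSignal_flipSignal {n : ℕ} (v : Fin n) (s : Fin n → Bool) :
    flipSignal v (flipSignal v s) = s := by
  simp [flipSignal_apply]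

section Weights

variable {n : ℕ} {q : ℝ}

theorem jointWeight_nonneg (h0 : 0 ≤ q) (h1 : q ≤ 1) (θ : Bool) (s : Fin n → Bool) :
    0 ≤ jointWeight q θ s :=
  mul_nonneg (by norm_num) (Finset.prod_nonneg fun v _ => by split_ifs <;> linarith)

/-- Reversal changes only the factor of `v`, and its two values add up to one. This expresses that,
given the state, the signal of `v` is independent of the others. -/
theorem jointWeight_eq_mul_add_flipSignal (θ : Bool) (s : Fin n → Bool) (v : Fin n) :
    jointWeight q θ s = (if s v = θ then q else 1 - q) *
      (jointWeight q θ s + jointWeight q θ (flipSignal v s)) := by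
  classical
  have h : ∀ t : Fin n → Bool, jointWeight q θ t = (if t v = θ then q else 1 - q) *
      ((1 / 2) * ∏ u ∈ Finset.univ.erase v, if t u = θ then q else 1 - q) := by
    intro t
    rw [jointWeight, ← Finset.mul_prod_erase _ _ (Finset.mem_univ v)]
    ring
  have hr : (∏ u ∈ Finset.univ.erase v, if flipSignal v s u = θ then q else 1 - q) =
      ∏ u ∈ Finset.univ.erase v, if s u = θ then q else 1 - q :=
    Finset.prod_congr rfl fun u hu => by rw [flipSignal_of_ne (Finset.ne_of_mem_erase hu)]
  rw [h s, h (flipSignal v s), hr, flipSignal_self, ← add_mul]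
  have : (if s v = θ then q else 1 - q) + (if (!(s v)) = θ then q else 1 - q) = 1 := by
    cases s v <;> cases θ <;> simp
  rw [this, one_mul]

theorem signalProb_mono (h0 : 0 ≤ q) (h1 : q ≤ 1) {E F : Bool → (Fin n → Bool) → Prop}
    (h : ∀ θ s, E θ s → F θ s) : signalProb q E ≤ signalProb q F := by
  classical
  refine Finset.sum_le_sum fun θ _ => Finset.sum_le_sum fun s _ => ?_
  have := jointWeight_nonneg h0 h1 θ s
  by_cases hE : E θ s
  · simp [hE, h θ s hE]
  · by_cases hF : F θ s <;> simp [hE, hF, this]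

theorem signalProb_nonneg (h0 : 0 ≤ q) (h1 : q ≤ 1) (E : Bool → (Fin n → Bool) → Prop) :
    0 ≤ signalProb q E := by
  refine Finset.sum_nonneg fun θ _ => Finset.sum_nonneg fun s _ => ?_
  have := jointWeight_nonneg h0 h1 θ s
  split_ifs <;> simp [this]

theorem signalProb_add_signalProb (E F : Bool → (Fin n → Bool) → Prop) :
    signalProb q E + signalProb q F =
      signalProb q (fun θ s => E θ s ∨ F θ s) + signalProb q (fun θ s => E θ s ∧ F θ s) := by
  simp only [signalProb, ← Finset.sum_add_distrib]
  refine Finset.sum_congr rfl fun θ _ => Finset.sum_congr rfl fun s _ => ?_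
  by_cases hE : E θ s <;> by_cases hF : F θ s <;> simp [hE, hF]

theorem signalProb_or_le (h0 : 0 ≤ q) (h1 : q ≤ 1) (E F : Bool → (Fin n → Bool) → Prop) :
    signalProb q (fun θ s => E θ s ∨ F θ s) ≤ signalProb q E + signalProb q F := by
  rw [signalProb_add_signalProb]
  exact le_add_of_nonneg_right (signalProb_nonneg h0 h1 _)

theorem signalProb_false : signalProb (n := n) q (fun _ _ => False) = 0 := by
  simp [signalProb]

theorem signalProb_add_of_disjoint (E F : Bool → (Fin n → Bool) → Prop)
    (h : ∀ θ s, E θ s → ¬ F θ s) :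
    signalProb q E + signalProb q F = signalProb q (fun θ s => E θ s ∨ F θ s) := by
  rw [signalProb_add_signalProb]
  have : (fun θ s => E θ s ∧ F θ s) = fun (_ : Bool) (_ : Fin n → Bool) => False := by
    funext θ s
    exact propext ⟨fun hh => h θ s hh.1 hh.2, False.elim⟩
  rw [this, signalProb_false, add_zero]

theorem signalProb_eq_and_add_and_not (E F : Bool → (Fin n → Bool) → Prop) :
    signalProb q E =
      signalProb q (fun θ s => E θ s ∧ F θ s) + signalProb q (fun θ s => E θ s ∧ ¬ F θ s) := by
  rw [signalProb_add_of_disjoint _ _ fun θ s h h' => h'.2 h.2]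
  congr 1
  funext θ s
  exact propext (by tauto)

/-- Given the state, the signals of finitely many agents take prescribed values with probability
at least `(1 - q)` to the number of these agents. -/
theorem le_signalProb_forall_mem_eq (hq : 1 / 2 ≤ q) (h1 : q ≤ 1) (θ₀ : Bool)
    (J : Finset (Fin n)) (s : Fin n → Bool) :
    (1 / 2) * (1 - q) ^ J.card ≤ signalProb q (fun θ t => θ = θ₀ ∧ ∀ v ∈ J, t v = s v) := by
  classical
  -- The constraint is built into the factors, so the probability becomes a product over agents. An
  -- agent outside `J` contributes one, an agent in `J` either `q` or `1 - q`.
  let g : Fin n → Bool → ℝ := fun v b =>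
    if v ∈ J → b = s v then (if b = θ₀ then q else 1 - q) else 0
  have h : signalProb q (fun θ t => θ = θ₀ ∧ ∀ v ∈ J, t v = s v) = (1 / 2) * ∏ v, ∑ b, g v b := by
    rw [Finset.prod_univ_sum, Fintype.piFinset_univ, Finset.mul_sum, signalProb,
      Finset.sum_eq_single_of_mem θ₀ (Finset.mem_univ _)]
    · refine Finset.sum_congr rfl fun t _ => ?_
      by_cases ht : ∀ v ∈ J, t v = s v
      · rw [if_pos ⟨rfl, ht⟩, jointWeight]
        congr 1
        exact Finset.prod_congr rfl fun v _ => (if_pos (ht v)).symm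
      · rw [if_neg (fun h => ht h.2)]
        push Not at ht
        obtain ⟨v, hv, hne⟩ := ht
        rw [Finset.prod_eq_zero (Finset.mem_univ v), mul_zero]
        exact if_neg fun h => hne (h hv)
    · intro θ _ hθ
      simp [hθ]
  rw [h]
  refine mul_le_mul_of_nonneg_left ?_ (by norm_num)
  calc (1 - q) ^ J.card = ∏ v, if v ∈ J then 1 - q else 1 := by
        rw [Finset.prod_ite_mem, Finset.univ_inter, Finset.prod_const]
    _ ≤ ∏ v, ∑ b, g v b := by
      refine Finset.prod_le_prod (fun v _ => by split_ifs <;> linarith) fun v _ => ?_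
      by_cases hv : v ∈ J
      · simp only [g, hv, if_true, Fintype.sum_bool, true_imp_iff]
        cases s v <;> cases θ₀ <;> simp <;> linarith
      · simp only [g, hv, if_false, Fintype.sum_bool, false_imp_iff, if_true]
        cases θ₀ <;> simp

theorem signalProb_state (θ₀ : Bool) :
    signalProb (n := n) q (fun θ _ => θ = θ₀) = 1 / 2 := by
  classical
  rw [signalProb, Finset.sum_eq_single_of_mem θ₀ (Finset.mem_univ _) (fun θ _ hθ => by simp [hθ])]
  simp only [if_true, jointWeight]
  rw [← Finset.mul_sum]
  have := (Finset.prod_univ_sum (fun _ : Fin n => (Finset.univ : Finset Bool))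
    (fun _ b => if b = θ₀ then q else 1 - q)).symm
  rw [Fintype.piFinset_univ] at this
  have h : (∑ b : Bool, if b = θ₀ then q else 1 - q) = 1 := by cases θ₀ <;> simp
  rw [this, h, Finset.prod_const_one, mul_one]

theorem signalProb_true : signalProb (n := n) q (fun _ _ => True) = 1 := by
  have h := signalProb_add_of_disjoint (n := n) (q := q) (fun θ _ => θ = true)
    (fun θ _ => θ = false) (fun θ s h h' => by simp [h] at h')
  rw [signalProb_state, signalProb_state] at h
  have h2 : (fun (θ : Bool) (_ : Fin n → Bool) => θ = true ∨ θ = false) = fun _ _ => True := by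
    funext θ s
    simp
  rw [← h2, ← h]
  norm_num

theorem signalProb_le_one (h0 : 0 ≤ q) (h1 : q ≤ 1) (E : Bool → (Fin n → Bool) → Prop) :
    signalProb q E ≤ 1 := by
  rw [← signalProb_true (n := n) (q := q)]
  exact signalProb_mono h0 h1 fun _ _ _ => trivial

/-- An event that does not depend on the signal of `v` is independent of the correctness of that
signal. -/
theorem signalProb_and_signal_eq (v : Fin n) (E : Bool → (Fin n → Bool) → Prop)
    (hE : ∀ θ s, E θ (flipSignal v s) ↔ E θ s) :
    signalProb q (fun θ s => E θ s ∧ s v = θ) = q * signalProb q E := by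
  classical
  simp only [signalProb, Finset.mul_sum]
  refine Finset.sum_congr rfl fun θ _ => ?_
  -- Pairing each profile with its reversal reduces the claim to a single pair.
  have h2 : ∀ f : (Fin n → Bool) → ℝ, ∑ s, f s = (1 / 2) * ∑ s, (f s + f (flipSignal v s)) := by
    intro f
    rw [Finset.sum_add_distrib, Equiv.sum_comp (flipSignal v) f]
    ring
  rw [h2, h2 fun s => q * _]
  congr 1
  refine Finset.sum_congr rfl fun s _ => ?_
  have e1 := jointWeight_eq_mul_add_flipSignal (q := q) θ s v
  have e2 := jointWeight_eq_mul_add_flipSignal (q := q) θ (flipSignal v s) v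
  rw [flipSignal_flipSignal, flipSignal_self] at e2
  simp only [hE, flipSignal_self]
  have hnot : (!(s v)) = θ ↔ ¬ s v = θ := by cases s v <;> cases θ <;> simp
  simp only [hnot] at e2 ⊢
  by_cases h : E θ s <;> by_cases hs : s v = θ <;>
    simp only [h, hs, not_true, not_false_eq_true, and_true, and_false,
      if_true, if_false] at e1 e2 ⊢ <;> linarith

/-- If for all signal profiles in `N`, one of the two values of the signal of `v` leads to `D`, then
`D` has conditional probability at least `1 - q` given `N`. -/
theorem mul_signalProb_le_of_flipSignal (hq : 1 / 2 ≤ q) (h1 : q ≤ 1) (v : Fin n)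
    (N D : (Fin n → Bool) → Prop) (hN : ∀ s, N (flipSignal v s) ↔ N s)
    (hD : ∀ s, N s → D s ∨ D (flipSignal v s)) :
    (1 - q) * signalProb q (fun _ => N) ≤ signalProb q (fun _ => D) := by
  classical
  simp only [signalProb, Finset.mul_sum]
  refine Finset.sum_le_sum fun θ _ => ?_
  have h2 : ∀ f : (Fin n → Bool) → ℝ, ∑ s, f s = (1 / 2) * ∑ s, (f s + f (flipSignal v s)) := by
    intro f
    rw [Finset.sum_add_distrib, Equiv.sum_comp (flipSignal v) f]
    ring
  rw [h2, h2 fun s => if D s then _ else _]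
  refine mul_le_mul_of_nonneg_left (Finset.sum_le_sum fun s _ => ?_) (by norm_num)
  have e1 := jointWeight_eq_mul_add_flipSignal (q := q) θ s v
  have e2 := jointWeight_eq_mul_add_flipSignal (q := q) θ (flipSignal v s) v
  rw [flipSignal_flipSignal] at e2
  have p1 := jointWeight_nonneg (by linarith) h1 θ s
  have p2 := jointWeight_nonneg (by linarith) h1 θ (flipSignal v s)
  -- Either member of a pair carries at least the fraction `1 - q` of the weight of the pair.
  have k1 : (1 - q) * (jointWeight q θ s + jointWeight q θ (flipSignal v s)) ≤
      jointWeight q θ s := by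
    refine le_trans ?_ e1.symm.le
    exact mul_le_mul_of_nonneg_right (by split_ifs <;> linarith) (add_nonneg p1 p2)
  have k2 : (1 - q) * (jointWeight q θ s + jointWeight q θ (flipSignal v s)) ≤
      jointWeight q θ (flipSignal v s) := by
    rw [add_comm]
    refine le_trans ?_ e2.symm.le
    exact mul_le_mul_of_nonneg_right (by split_ifs <;> linarith) (add_nonneg p2 p1)
  simp only [hN]
  by_cases h : N s
  · simp only [h, if_true]
    rcases hD s h with hd | hd
    · by_cases hd' : D (flipSignal v s) <;> simp only [hd, hd', if_true, if_false] <;> linarith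
    · by_cases hd' : D s <;> simp only [hd, hd', if_true, if_false] <;> linarith
  · simp only [h, if_false, mul_zero, add_zero]
    split_ifs <;> linarith

/-- Probabilities can be compared on each class of an equivalence relation between signal
profiles. -/
theorem signalProb_le_of_forall_class (r : Setoid (Fin n → Bool))
    (E F : Bool → (Fin n → Bool) → Prop)
    (h : ∀ s, signalProb q (fun θ t => E θ t ∧ r s t) ≤ signalProb q (fun θ t => F θ t ∧ r s t)) :
    signalProb q E ≤ signalProb q F := by
  classical
  have key : ∀ X : Bool → (Fin n → Bool) → Prop, signalProb q X =
      ∑ c : Quotient r, signalProb q (fun θ t => X θ t ∧ Quotient.mk r t = c) := by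
    intro X
    simp only [signalProb]
    refine Eq.trans (Finset.sum_congr rfl fun θ _ => ?_) Finset.sum_comm
    refine Eq.trans (Finset.sum_congr rfl fun s _ => ?_) Finset.sum_comm
    by_cases hX : X θ s <;> simp [hX]
  rw [key E, key F]
  refine Finset.sum_le_sum fun c _ => ?_
  induction c using Quotient.inductionOn with
  | h s =>
    have hs : ∀ t, Quotient.mk r t = Quotient.mk r s ↔ r s t := fun t =>
      Quotient.eq.trans ⟨fun h => r.symm h, fun h => r.symm h⟩
    simpa only [hs] using h s

end Weights

/-! ### Information and optimality in a Bayesian play -/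

theorem ignoresSignal_iff {n : ℕ} {a : Fin n → (Fin n → Bool) → Bool} {v : Fin n}
    {s : Fin n → Bool} : IgnoresSignal a v s ↔ a v (flipSignal v s) = a v s := Iff.rfl

theorem ignoresSignal_flipSignal {n : ℕ} {a : Fin n → (Fin n → Bool) → Bool} {v : Fin n}
    {s : Fin n → Bool} : IgnoresSignal a v (flipSignal v s) ↔ IgnoresSignal a v s := by
  rw [ignoresSignal_iff, ignoresSignal_iff, flipSignal_flipSignal, eq_comm]

/-- Signal profiles leading to the same actions of all agents that decide before `v`. -/
def samePast {n : ℕ} (σ : Equiv.Perm (Fin n)) (a : Fin n → (Fin n → Bool) → Bool) (v : Fin n) :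
    Setoid (Fin n → Bool) where
  r s t := ∀ w, σ w < σ v → a w s = a w t
  iseqv := ⟨fun _ _ _ => rfl, fun h w hw => (h w hw).symm,
    fun h h' w hw => (h w hw).trans (h' w hw)⟩

/-- `SameInfo` as an equivalence relation. -/
def sameInfoSetoid {n : ℕ} (G : SimpleGraph (Fin n)) (σ : Equiv.Perm (Fin n))
    (a : Fin n → (Fin n → Bool) → Bool) (v : Fin n) : Setoid (Fin n → Bool) where
  r := SameInfo G σ a v
  iseqv := ⟨fun _ => ⟨rfl, fun _ _ => rfl⟩, fun h => ⟨h.1.symm, fun u hu => (h.2 u hu).symm⟩,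
    fun h h' => ⟨h.1.trans h'.1, fun u hu => (h.2 u hu).trans (h'.2 u hu)⟩⟩

namespace IsBayesianPlay

variable {n : ℕ} {G : SimpleGraph (Fin n)} {q : ℝ} {σ : Equiv.Perm (Fin n)}
  {a : Fin n → (Fin n → Bool) → Bool}

theorem action_eq_of_forall_le (h : IsBayesianPlay G q σ a) {s t : Fin n → Bool} (v : Fin n)
    (hst : ∀ u, σ u ≤ σ v → s u = t u) : a v s = a v t := by
  induction hk : (σ v : ℕ) using Nat.strong_induction_on generalizing v with
  | _ k ih =>
    refine h.adapted v s t ⟨hst v le_rfl, fun u hu => ?_⟩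
    have hu := (mem_earlierNeighbors.mp hu).2
    exact ih (σ u) (hk ▸ hu) u (fun w hw => hst w (hw.trans hu.le)) rfl

theorem action_flipSignal (h : IsBayesianPlay G q σ a) {u v : Fin n} (huv : σ u < σ v)
    (s : Fin n → Bool) : a u (flipSignal v s) = a u s := by
  refine h.action_eq_of_forall_le u fun w hw => flipSignal_of_ne ?_ s
  rintro rfl
  exact absurd huv (not_lt.mpr hw)

theorem sameInfo_or_sameInfo_flipSignal (h : IsBayesianPlay G q σ a) {v : Fin n}
    {s t : Fin n → Bool} (hst : ∀ u ∈ earlierNeighbors G σ v, a u s = a u t) :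
    SameInfo G σ a v s t ∨ SameInfo G σ a v (flipSignal v s) t := by
  by_cases hv : s v = t v
  · exact Or.inl ⟨hv, hst⟩
  · refine Or.inr ⟨?_, fun u hu => ?_⟩
    · rw [flipSignal_self]
      revert hv
      cases s v <;> cases t v <;> simp
    · rw [h.action_flipSignal (mem_earlierNeighbors.mp hu).2, hst u hu]

/-- With equal observations, the information at `t` is that at `s` or at its reversal, and `v` acts
alike at both. -/
theorem action_eq_of_ignoresSignal (h : IsBayesianPlay G q σ a) {v : Fin n} {s t : Fin n → Bool}
    (hst : ∀ u ∈ earlierNeighbors G σ v, a u s = a u t) (hv : IgnoresSignal a v s) :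
    a v s = a v t := by
  rcases h.sameInfo_or_sameInfo_flipSignal hst with hh | hh
  · exact h.adapted v s t hh
  · exact (ignoresSignal_iff.mp hv).symm.trans (h.adapted v _ t hh)

theorem ignoresSignal_of_ignoresSignal (h : IsBayesianPlay G q σ a) {v : Fin n}
    {s t : Fin n → Bool} (hst : ∀ u ∈ earlierNeighbors G σ v, a u s = a u t)
    (hv : IgnoresSignal a v s) : IgnoresSignal a v t := by
  refine ignoresSignal_iff.mpr ?_
  rw [← h.action_eq_of_ignoresSignal hst hv]
  refine (h.action_eq_of_ignoresSignal (fun u hu => ?_) hv).symm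
  rw [h.action_flipSignal (mem_earlierNeighbors.mp hu).2, hst u hu]

/-- The signals of the agents that do not ignore them determine all actions. -/
theorem action_eq_of_forall_not_ignoresSignal (h : IsBayesianPlay G q σ a) {s t : Fin n → Bool}
    (hst : ∀ v, ¬ IgnoresSignal a v s → t v = s v) (v : Fin n) : a v s = a v t := by
  induction hk : (σ v : ℕ) using Nat.strong_induction_on generalizing v with
  | _ k ih =>
    have hobs : ∀ u ∈ earlierNeighbors G σ v, a u s = a u t := fun u hu =>
      ih (σ u) (hk ▸ (mem_earlierNeighbors.mp hu).2) u rfl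
    by_cases hv : IgnoresSignal a v s
    · exact h.action_eq_of_ignoresSignal hobs hv
    · exact h.adapted v s t ⟨(hst v hv).symm, hobs⟩

/-- No rule based on the information of an agent is better than its action. -/
theorem signalProb_eq_le (h : IsBayesianPlay G q σ a) (v : Fin n) (f : (Fin n → Bool) → Bool)
    (hf : ∀ s t, SameInfo G σ a v s t → f s = f t) :
    signalProb q (fun θ s => f s = θ) ≤ signalProb q (fun θ s => a v s = θ) := by
  refine signalProb_le_of_forall_class (sameInfoSetoid G σ a v) _ _ fun s => ?_
  have e : ∀ g : (Fin n → Bool) → Bool, (∀ t, SameInfo G σ a v s t → g s = g t) →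
      (fun (θ : Bool) t => g t = θ ∧ sameInfoSetoid G σ a v s t) =
        fun θ t => θ = g s ∧ SameInfo G σ a v s t := by
    intro g hg
    funext θ t
    refine propext ⟨fun ⟨h1, h2⟩ => ⟨?_, h2⟩, fun ⟨h1, h2⟩ => ⟨?_, h2⟩⟩
    · rw [hg t h2, h1]
    · rw [← hg t h2, h1]
  rw [e f (hf s), e (a v) fun t => h.adapted v s t]
  by_cases hfa : f s = a v s
  · rw [hfa]
  · have : f s = !(a v s) := by
      revert hfa
      cases f s <;> cases a v s <;> simp
    rw [this]
    exact h.optimal v s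

theorem le_signalProb_correct (h : IsBayesianPlay G q σ a) (v : Fin n) :
    q ≤ signalProb q (fun θ s => a v s = θ) := by
  refine le_trans (le_of_eq ?_) (h.signalProb_eq_le v (fun s => s v) fun s t hst => hst.1)
  have := signalProb_and_signal_eq (q := q) v (fun _ _ => True) (by simp)
  simpa [signalProb_true] using this.symm

theorem signalProb_correct_le (h : IsBayesianPlay G q σ a) {u v : Fin n} (huv : G.Adj u v)
    (hσ : σ u < σ v) :
    signalProb q (fun θ s => a u s = θ) ≤ signalProb q (fun θ s => a v s = θ) :=
  h.signalProb_eq_le v (a u) fun _ _ hst => hst.2 u (mem_earlierNeighbors.mpr ⟨huv, hσ⟩)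

/-- Along a triangle, disagreement improves the quality of the last decision. -/
theorem mul_signalProb_ne_le (h : IsBayesianPlay G q σ a) {u v w : Fin n}
    (huv : G.Adj u v) (hvw : G.Adj v w) (huw : G.Adj u w) (hσ : σ u < σ v) (hσ' : σ v < σ w) :
    (q - 1 / 2) * signalProb q (fun _ s => a v s ≠ a u s) ≤
      signalProb q (fun θ s => a w s = θ) - signalProb q (fun θ s => a u s = θ) := by
  classical
  have hu := mem_earlierNeighbors.mpr ⟨huw, hσ.trans hσ'⟩
  have hv := mem_earlierNeighbors.mpr ⟨hvw, hσ'⟩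
  -- Agent `w` does at least as well as by copying `u` unless `v` disagrees, and following its own
  -- signal then. That signal is right with probability `q` independently of the disagreement.
  have h1 := h.signalProb_eq_le w (fun s => if a v s ≠ a u s then s w else a u s)
    fun s t hst => by
      simp only [hst.1, hst.2 u hu, hst.2 v hv]
  have h2 := h.signalProb_correct_le huv hσ
  have h3 := signalProb_and_signal_eq (q := q) w (fun _ s => a v s ≠ a u s) fun θ s => by
    rw [h.action_flipSignal (hσ.trans hσ'), h.action_flipSignal hσ']
  have h4 : signalProb q (fun θ s => (if a v s ≠ a u s then s w else a u s) = θ) =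
      signalProb q (fun θ s => a v s = a u s ∧ a u s = θ) +
        signalProb q (fun θ s => a v s ≠ a u s ∧ s w = θ) := by
    rw [signalProb_add_of_disjoint _ _ fun θ s h h' => h'.1 h.1]
    congr 1
    funext θ s
    by_cases hh : a v s = a u s <;> simp [hh]
  -- When `u` and `v` disagree, exactly one is right. As `v` is at least as good as `u`, copying `u`
  -- is right on at most half of the disagreement, against `q` for the signal of `w`.
  have h5 : signalProb q (fun θ s => a u s = θ) + signalProb q (fun θ s => a v s = θ) =
      2 * signalProb q (fun θ s => a v s = a u s ∧ a u s = θ) +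
        signalProb q (fun _ s => a v s ≠ a u s) := by
    simp only [signalProb, Finset.mul_sum, ← Finset.sum_add_distrib]
    refine Finset.sum_congr rfl fun θ _ => Finset.sum_congr rfl fun s _ => ?_
    by_cases hh : a v s = a u s
    · by_cases hθ : a u s = θ
      · simp [hh, hθ]; ring
      · simp [hh, hθ]
    · have hvu : a v s = !(a u s) := by
        revert hh
        cases a v s <;> cases a u s <;> simp
      by_cases hθ : a u s = θ
      · simp [hvu, hθ]
      · have : (!(a u s)) = θ := by
          revert hθ
          cases a u s <;> cases θ <;> simp
        simp [hvu, this, hθ, Ne.symm hθ]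
  nlinarith

/-- The action of `u` does not depend on the signal of `v`. If `v` uses its signal, one of the two
signal values makes it differ from `u`. -/
theorem mul_signalProb_not_ignoresSignal_le (h : IsBayesianPlay G q σ a) (hq : 1 / 2 ≤ q)
    (hq' : q ≤ 1) {u v : Fin n} (hσ : σ u < σ v) :
    (1 - q) * signalProb q (fun _ s => ¬ IgnoresSignal a v s) ≤
      signalProb q (fun _ s => a v s ≠ a u s) := by
  refine mul_signalProb_le_of_flipSignal hq hq' v _ _
    (fun s => not_congr ignoresSignal_flipSignal) fun s hs => ?_
  rw [ignoresSignal_iff] at hs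
  rw [h.action_flipSignal hσ]
  by_contra! hh
  exact hs (hh.2.trans hh.1.symm)

end IsBayesianPlay

/-- The triangle sum is applied with `e` the error probability; the constant combines the factors `1
- q` and `q - 1 / 2` of the two preceding estimates. The bound depends on neither `n` nor the order.
-/
theorem ComplLocallySparse.sum_signalProb_not_ignoresSignal_le {n : ℕ} {G : SimpleGraph (Fin n)}
    {N m k : ℕ} (hG : ComplLocallySparse G N m) (hm : m + k * N ≤ N.choose 2)
    (hG' : ComplLocallySparse G (2 * (k + 1)) ((k + 1) * (k + 1))) {q : ℝ} (hq : 1 / 2 < q)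
    (hq' : q < 1) {σ : Equiv.Perm (Fin n)} {a : Fin n → (Fin n → Bool) → Bool}
    (h : IsBayesianPlay G q σ a) :
    ∑ v, signalProb q (fun _ s => ¬ IgnoresSignal a v s) ≤
      2 * N + ((1 - q) * (q - 1 / 2))⁻¹ * (2 * N) := by
  have h1 : 0 < 1 - q := by linarith
  have h2 : 0 < q - 1 / 2 := by linarith
  have h0 : 0 ≤ q := by linarith
  refine hG.sum_le hm hG' σ (fun v => 1 - signalProb q (fun θ s => a v s = θ)) _ (by positivity)
    (fun v => sub_nonneg.mpr (signalProb_le_one h0 hq'.le _))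
    (fun v => sub_le_self _ (signalProb_nonneg h0 hq'.le _))
    (fun v => signalProb_le_one h0 hq'.le _) ?_
  intro u v w huv hvw huw hσ hσ'
  have e1 := h.mul_signalProb_ne_le huv hvw huw hσ hσ'
  have e2 := h.mul_signalProb_not_ignoresSignal_le hq.le hq'.le hσ
  rw [le_inv_mul_iff₀ (by positivity)]
  have e3 := mul_le_mul_of_nonneg_left e2 h2.le
  linarith

/-! ### Expected counts and Markov's inequality -/

section Sums

variable {n : ℕ} {q : ℝ}

theorem sum_signalProb (E : Fin n → Bool → (Fin n → Bool) → Prop) :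
    open Classical in
    ∑ v, signalProb q (E v) = ∑ θ, ∑ s, ∑ v, if E v θ s then jointWeight q θ s else 0 := by
  simp only [signalProb]
  refine Finset.sum_comm.trans (Finset.sum_congr rfl fun θ _ => ?_)
  exact Finset.sum_comm

theorem signalProb_exists_le_sum (h0 : 0 ≤ q) (h1 : q ≤ 1)
    (E : Fin n → Bool → (Fin n → Bool) → Prop) :
    signalProb q (fun θ s => ∃ v, E v θ s) ≤ ∑ v, signalProb q (E v) := by
  classical
  rw [sum_signalProb, signalProb]
  refine Finset.sum_le_sum fun θ _ => Finset.sum_le_sum fun s _ => ?_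
  have hw := jointWeight_nonneg h0 h1 θ s
  have hnn : ∀ v ∈ Finset.univ, 0 ≤ if E v θ s then jointWeight q θ s else 0 := fun v _ => by
    split_ifs <;> simp [hw]
  by_cases h : ∃ v, E v θ s
  · obtain ⟨v, hv⟩ := h
    rw [if_pos ⟨v, hv⟩]
    exact (if_pos hv).symm.le.trans (Finset.single_le_sum hnn (Finset.mem_univ v))
  · rw [if_neg h]
    exact Finset.sum_nonneg hnn

theorem sum_signalProb_le_of_disjoint (h0 : 0 ≤ q) (h1 : q ≤ 1)
    (E : Fin n → Bool → (Fin n → Bool) → Prop) (F : Bool → (Fin n → Bool) → Prop)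
    (hEF : ∀ v θ s, E v θ s → F θ s) (hE : ∀ v w θ s, E v θ s → E w θ s → v = w) :
    ∑ v, signalProb q (E v) ≤ signalProb q F := by
  classical
  rw [sum_signalProb, signalProb]
  refine Finset.sum_le_sum fun θ _ => Finset.sum_le_sum fun s _ => ?_
  have hw := jointWeight_nonneg h0 h1 θ s
  by_cases h : ∃ v, E v θ s
  · obtain ⟨v, hv⟩ := h
    rw [Finset.sum_eq_single_of_mem v (Finset.mem_univ v), if_pos hv, if_pos (hEF v θ s hv)]
    exact fun w _ hwv => if_neg fun hw => hwv (hE w v θ s hw hv)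
  · rw [Finset.sum_eq_zero fun v _ => if_neg fun hv => h ⟨v, hv⟩]
    split_ifs <;> simp [hw]

/-- The sum of probabilities is the expectation of the number of events that occur. -/
theorem sum_signalProb_eq (E : Fin n → Bool → (Fin n → Bool) → Prop) :
    ∑ v, signalProb q (E v) =
      ∑ θ, ∑ s, jointWeight q θ s * (({v | E v θ s} : Set (Fin n)).ncard : ℝ) := by
  classical
  rw [sum_signalProb]
  refine Finset.sum_congr rfl fun θ _ => Finset.sum_congr rfl fun s _ => ?_
  rw [← Finset.sum_filter, Finset.sum_const, nsmul_eq_mul, mul_comm, ← Set.ncard_coe_finset]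
  simp

theorem mul_signalProb_lt_ncard_le (h0 : 0 ≤ q) (h1 : q ≤ 1)
    (E : Fin n → Bool → (Fin n → Bool) → Prop) (K : ℕ) :
    K * signalProb q (fun θ s => K < ({v | E v θ s} : Set (Fin n)).ncard) ≤
      ∑ v, signalProb q (E v) := by
  classical
  rw [sum_signalProb_eq, signalProb, Finset.mul_sum]
  refine Finset.sum_le_sum fun θ _ => ?_
  rw [Finset.mul_sum]
  refine Finset.sum_le_sum fun s _ => ?_
  have hw := jointWeight_nonneg h0 h1 θ s
  split_ifs with h
  · rw [mul_comm]
    exact mul_le_mul_of_nonneg_left (by exact_mod_cast h.le) hw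
  · rw [mul_zero]
    positivity

end Sums

/-! ### Likely histories and herding on the wrong state -/

namespace IsBayesianPlay

variable {n : ℕ} {G : SimpleGraph (Fin n)} {q : ℝ} {σ : Equiv.Perm (Fin n)}
  {a : Fin n → (Fin n → Bool) → Bool}

theorem obs_of_samePast {v : Fin n} {s t : Fin n → Bool} (hst : samePast σ a v s t) :
    ∀ u ∈ earlierNeighbors G σ v, a u s = a u t := fun u hu =>
  hst u (mem_earlierNeighbors.mp hu).2

/-- After a likely history, an agent that is unlikely to use its signal ignores it. -/
theorem ignoresSignal_of_le (h : IsBayesianPlay G q σ a) (h0 : 0 ≤ q) (h1 : q ≤ 1) {η : ℝ}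
    {v w : Fin n} (hwv : σ w ≤ σ v) {s : Fin n → Bool}
    (hs : η ≤ signalProb q (fun _ t => samePast σ a v s t))
    (hw : signalProb q (fun _ t => ¬ IgnoresSignal a w t) < η) : IgnoresSignal a w s := by
  by_contra hn
  -- Whether `w` ignores its signal depends only on what it observes, so a use at `s` is a use
  -- throughout a class of probability at least `η`.
  have hsub : ∀ t, samePast σ a v s t → ¬ IgnoresSignal a w t := by
    intro t ht hi
    have hobs : ∀ u ∈ earlierNeighbors G σ w, a u t = a u s := fun u hu =>
      (ht u ((mem_earlierNeighbors.mp hu).2.trans_le hwv)).symm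
    exact hn (h.ignoresSignal_of_ignoresSignal hobs hi)
  exact absurd (hs.trans (signalProb_mono h0 h1 fun _ t ht => hsub t ht)) (not_le.mpr hw)

/-- After a likely history, an agent that observes all agents that are likely to use their signals
knows the whole history. -/
theorem samePast_of_obs (h : IsBayesianPlay G q σ a) (h0 : 0 ≤ q) (h1 : q ≤ 1) {η : ℝ}
    {v : Fin n} {s t : Fin n → Bool}
    (hs : η ≤ signalProb q (fun _ t => samePast σ a v s t))
    (hv : ∀ w, σ w < σ v → η ≤ signalProb q (fun _ t => ¬ IgnoresSignal a w t) → G.Adj w v)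
    (hst : ∀ u ∈ earlierNeighbors G σ v, a u s = a u t) : samePast σ a v s t := by
  suffices H : ∀ k : ℕ, ∀ w, (σ w : ℕ) = k → σ w < σ v → a w s = a w t from
    fun w hw => H _ w rfl hw
  intro k
  induction k using Nat.strong_induction_on with
  | _ k ih =>
    intro w hk hw
    by_cases hl : η ≤ signalProb q (fun _ t => ¬ IgnoresSignal a w t)
    · exact hst w (mem_earlierNeighbors.mpr ⟨hv w hw hl, hw⟩)
    · refine h.action_eq_of_ignoresSignal (fun u hu => ?_)
        (h.ignoresSignal_of_le h0 h1 hw.le hs (not_le.mp hl))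
      have hu := (mem_earlierNeighbors.mp hu).2
      exact ih (σ u) (hk ▸ hu) u rfl (hu.trans hw)

/-- A likely history after which such an agent acts `true` is evidence for `true`. -/
theorem signalProb_false_le_true (h : IsBayesianPlay G q σ a) (h0 : 0 ≤ q) (h1 : q ≤ 1) {η : ℝ}
    {v : Fin n} {s : Fin n → Bool}
    (hs : η ≤ signalProb q (fun _ t => samePast σ a v s t))
    (hv : ∀ w, σ w < σ v → η ≤ signalProb q (fun _ t => ¬ IgnoresSignal a w t) → G.Adj w v)
    (hl : signalProb q (fun _ t => ¬ IgnoresSignal a v t) < η) (ha : a v s = true) :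
    signalProb q (fun θ t => θ = false ∧ samePast σ a v s t) ≤
      signalProb q (fun θ t => θ = true ∧ samePast σ a v s t) := by
  have hi := h.ignoresSignal_of_le h0 h1 le_rfl hs hl
  have ha' : a v (flipSignal v s) = true := (ignoresSignal_iff.mp hi).trans ha
  have o1 := h.optimal v s
  have o2 := h.optimal v (flipSignal v s)
  rw [ha] at o1
  rw [ha'] at o2
  -- Since `v` knows the history, its information sets for the two signal values partition the
  -- history class. It acts `true` on both, so the two optimality inequalities add up.
  have e : ∀ b : Bool, signalProb q (fun θ t => θ = b ∧ samePast σ a v s t) =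
      signalProb q (fun θ t => θ = b ∧ SameInfo G σ a v s t) +
        signalProb q (fun θ t => θ = b ∧ SameInfo G σ a v (flipSignal v s) t) := by
    intro b
    rw [signalProb_add_of_disjoint]
    · congr 1
      funext θ t
      refine propext ⟨fun ⟨hb, ht⟩ => ?_, fun ht => ?_⟩
      · exact (h.sameInfo_or_sameInfo_flipSignal (obs_of_samePast ht)).imp (⟨hb, ·⟩) (⟨hb, ·⟩)
      · rcases ht with ⟨hb, ht⟩ | ⟨hb, ht⟩
        · exact ⟨hb, h.samePast_of_obs h0 h1 hs hv ht.2⟩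
        · refine ⟨hb, h.samePast_of_obs h0 h1 hs hv fun u hu => ?_⟩
          rw [← ht.2 u hu, h.action_flipSignal (mem_earlierNeighbors.mp hu).2]
    · rintro θ t ⟨-, h1⟩ ⟨-, h2⟩
      have := h1.1.trans h2.1.symm
      rw [flipSignal_self] at this
      simp at this
  rw [e, e]
  exact add_le_add o1 o2

/-- Under the state `false`, the first action is `false`, but after some likely history an agent
that knows the history acts `true`: this is no more likely than the first action being `false`
under the state `true`. -/
theorem signalProb_exists_reversal_le (h : IsBayesianPlay G q σ a) (h0 : 0 ≤ q) (h1 : q ≤ 1)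
    {η : ℝ} (v₀ : Fin n) (W : Fin n → Prop)
    (hW : ∀ v, W v → σ v₀ < σ v ∧ signalProb q (fun _ t => ¬ IgnoresSignal a v t) < η ∧
      ∀ w, σ w < σ v → η ≤ signalProb q (fun _ t => ¬ IgnoresSignal a w t) → G.Adj w v) :
    signalProb q (fun θ t => θ = false ∧ ∃ v, W v ∧ a v₀ t = false ∧ a v t = true ∧
        η ≤ signalProb q (fun _ t' => samePast σ a v t t')) ≤
      signalProb q (fun θ t => θ = true ∧ a v₀ t = false) := by
  let D : Fin n → (Fin n → Bool) → Prop := fun v t => W v ∧ a v₀ t = false ∧ a v t = true ∧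
    η ≤ signalProb q (fun _ t' => samePast σ a v t t')
  -- First reversals are disjoint events, and each is a union of history classes of `v`. They can
  -- thus be compared between the two states class by class and then summed.
  let D' : Fin n → (Fin n → Bool) → Prop := fun v t => D v t ∧ ∀ w, σ w < σ v → ¬ D w t
  have hD : ∀ {v w s t}, σ w ≤ σ v → samePast σ a v s t → D w s → D w t := by
    rintro v w s t hwv hst ⟨hw, ha0, ha, hη⟩
    have hst' : samePast σ a w s t := fun u hu => hst u (hu.trans_le hwv)
    obtain ⟨hw0, hwl, -⟩ := hW w hw
    refine ⟨hw, (hst' v₀ hw0).symm.trans ha0, ?_, hη.trans (signalProb_mono h0 h1 fun _ t' ht' =>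
      (samePast σ a w).trans ((samePast σ a w).symm hst') ht')⟩
    rw [← h.action_eq_of_ignoresSignal (obs_of_samePast hst')
      (h.ignoresSignal_of_le h0 h1 le_rfl hη hwl), ha]
  have hD' : ∀ {v s t}, samePast σ a v s t → D' v s → D' v t := fun hst hs =>
    ⟨hD le_rfl hst hs.1, fun w hw hwt =>
      hs.2 w hw (hD hw.le ((samePast σ a _).symm hst) hwt)⟩
  have hle : ∀ v, signalProb q (fun θ t => θ = false ∧ D' v t) ≤
      signalProb q (fun θ t => θ = true ∧ D' v t) := by
    intro v
    refine signalProb_le_of_forall_class (samePast σ a v) _ _ fun s => ?_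
    by_cases hs : D' v s
    · have e : ∀ b : Bool, (fun θ t => (θ = b ∧ D' v t) ∧ samePast σ a v s t) =
          fun θ t => θ = b ∧ samePast σ a v s t := by
        intro b
        funext θ t
        exact propext ⟨fun hh => ⟨hh.1.1, hh.2⟩, fun hh => ⟨⟨hh.1, hD' hh.2 hs⟩, hh.2⟩⟩
      rw [e, e]
      obtain ⟨hw, -, ha, hη⟩ := hs.1
      exact h.signalProb_false_le_true h0 h1 hη (hW v hw).2.2 (hW v hw).2.1 ha
    · refine signalProb_mono h0 h1 fun θ t hh => ?_
      exact absurd (hD' ((samePast σ a v).symm hh.2) hh.1.2) hs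
  have hfirst : ∀ t, (∃ v, D v t) → ∃ v, D' v t := by
    rintro t ⟨v, hv⟩
    induction hk : (σ v : ℕ) using Nat.strong_induction_on generalizing v with
    | _ k ih =>
      by_cases hw : ∃ w, σ w < σ v ∧ D w t
      · obtain ⟨w, hw, hwt⟩ := hw
        exact ih (σ w) (hk ▸ hw) w hwt rfl
      · push Not at hw
        exact ⟨v, hv, hw⟩
  calc _ ≤ signalProb q (fun θ t => ∃ v, θ = false ∧ D' v t) :=
        signalProb_mono h0 h1 fun θ t ⟨hθ, hv⟩ => (hfirst t hv).imp fun v hv => ⟨hθ, hv⟩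
    _ ≤ ∑ v, signalProb q (fun θ t => θ = false ∧ D' v t) := signalProb_exists_le_sum h0 h1 _
    _ ≤ ∑ v, signalProb q (fun θ t => θ = true ∧ D' v t) := Finset.sum_le_sum fun v _ => hle v
    _ ≤ _ := sum_signalProb_le_of_disjoint h0 h1 _ _ (fun v θ t hv => ⟨hv.1, hv.2.1.2.1⟩)
        fun v w θ t hv hw => by
          rcases lt_trichotomy (σ v) (σ w) with hlt | heq | hlt
          · exact absurd hv.2.1 (hw.2.2 v hlt)
          · exact σ.injective heq
          · exact absurd hw.2.1 (hv.2.2 w hlt)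

/-- If few agents use their signals on average, then with probability bounded below the agents herd
on the wrong state. -/
theorem le_signalProb_wrongHerd (h : IsBayesianPlay G q σ a) (hq : 1 / 2 < q) (hq' : q < 1)
    (hn : 0 < n) {C : ℝ} (hC : ∑ v, signalProb q (fun _ s => ¬ IgnoresSignal a v s) ≤ C) {K : ℕ}
    (hK : C < K * (q - 1 / 2)) {β : ℝ} {d : ℕ} (hG : ComplDegreeLT G d)
    (hd : C / ((1 / 2) * (1 - q) ^ K) * (d + 1) ≤ β * n) :
    (1 / 2) * (1 - q) ^ K ≤ signalProb q (WrongHerd K β a) := by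
  classical
  have h0 : 0 ≤ q := by linarith
  have h1 : 0 < 1 - q := by linarith
  set η : ℝ := (1 / 2) * (1 - q) ^ K with hη
  have hη0 : 0 < η := by positivity
  have hKpos : (0 : ℝ) < K := by
    have : 0 ≤ C := (Finset.sum_nonneg fun v _ => signalProb_nonneg h0 hq'.le _).trans hC
    by_contra! hle
    nlinarith
  let J : (Fin n → Bool) → Finset (Fin n) := fun s =>
    Finset.univ.filter fun v => ¬ IgnoresSignal a v s
  have hJ : ∀ s, {v | ¬ IgnoresSignal a v s}.ncard = (J s).card := by
    intro s
    rw [← Set.ncard_coe_finset]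
    simp [J]
  have hJη : ∀ s, (J s).card ≤ K →
      η ≤ signalProb q (fun θ t => θ = true ∧ ∀ v ∈ J s, t v = s v) := fun s hs =>
    (mul_le_mul_of_nonneg_left (pow_le_pow_of_le_one h1.le (by linarith) hs) (by norm_num)).trans
      (le_signalProb_forall_mem_eq hq.le hq'.le true (J s) s)
  have hact : ∀ {s t : Fin n → Bool}, (∀ v ∈ J s, t v = s v) → ∀ v, a v s = a v t := fun hst =>
    h.action_eq_of_forall_not_ignoresSignal fun v hv =>
      hst v (Finset.mem_filter.mpr ⟨Finset.mem_univ _, hv⟩)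
  -- In contrast to `J s`, which depends on the profile, `H` is fixed and has bounded size.
  let H : Finset (Fin n) := Finset.univ.filter fun v =>
    η ≤ signalProb q (fun _ t => ¬ IgnoresSignal a v t)
  have hH : (H.card : ℝ) ≤ C / η := by
    rw [le_div_iff₀ hη0]
    calc (H.card : ℝ) * η = ∑ v ∈ H, η := by rw [Finset.sum_const, nsmul_eq_mul]
      _ ≤ ∑ v ∈ H, signalProb q (fun _ t => ¬ IgnoresSignal a v t) :=
        Finset.sum_le_sum fun v hv => (Finset.mem_filter.mp hv).2
      _ ≤ ∑ v, signalProb q (fun _ t => ¬ IgnoresSignal a v t) :=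
        Finset.sum_le_sum_of_subset_of_nonneg (Finset.subset_univ _)
          fun v _ _ => signalProb_nonneg h0 hq'.le _
      _ ≤ C := hC
  let v₀ : Fin n := σ.symm ⟨0, hn⟩
  have hv₀ : ∀ v, v ≠ v₀ → σ v₀ < σ v := by
    intro v hv
    have h2 : σ v ≠ σ v₀ := fun e => hv (σ.injective e)
    rw [Fin.lt_def]
    have h3 : (σ v₀ : ℕ) = 0 := by simp [v₀]
    have h4 : (σ v : ℕ) ≠ σ v₀ := fun e => h2 (Fin.ext e)
    omega
  -- These agents know every likely history and ignore their signals after it.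
  let W : Fin n → Prop := fun v => v ≠ v₀ ∧ v ∉ H ∧ ∀ w ∈ H, G.Adj w v
  have hrev := h.signalProb_exists_reversal_le h0 hq'.le (η := η) v₀ W fun v ⟨hv, hvH, hvw⟩ =>
    ⟨hv₀ v hv, not_le.mp fun hle => hvH (Finset.mem_filter.mpr ⟨Finset.mem_univ _, hle⟩),
      fun w _ hw => hvw w (Finset.mem_filter.mpr ⟨Finset.mem_univ _, hw⟩)⟩
  have hmarkov := mul_signalProb_lt_ncard_le h0 hq'.le (fun v _ s => ¬ IgnoresSignal a v s) K
  simp only [hJ] at hmarkov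
  have hfirst : q - 1 / 2 + signalProb q (fun θ t => θ = true ∧ a v₀ t = false) ≤
      signalProb q (fun θ t => θ = false ∧ a v₀ t = false) := by
    have e1 := h.le_signalProb_correct v₀
    have e2 := signalProb_eq_and_add_and_not (q := q) (fun θ s => a v₀ s = θ) (fun θ _ => θ = true)
    have e3 := signalProb_eq_and_add_and_not (q := q) (fun θ _ => θ = true)
      (fun _ s => a v₀ s = false)
    rw [signalProb_state (n := n) true] at e3
    have e4 : signalProb q (fun θ s => a v₀ s = θ ∧ θ = true) =
        signalProb q (fun θ s => θ = true ∧ ¬ a v₀ s = false) := by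
      congr 1
      funext θ s
      cases θ <;> cases a v₀ s <;> simp
    have e5 : signalProb q (fun θ s => a v₀ s = θ ∧ ¬ θ = true) =
        signalProb q (fun θ s => θ = false ∧ a v₀ s = false) := by
      congr 1
      funext θ s
      cases θ <;> cases a v₀ s <;> simp
    linarith
  -- Otherwise each profile with first action `false` has a reversal or more than `K` users. By
  -- `hrev` and `hfirst` the latter would have probability at least `q - 1 / 2`, against Markov's
  -- inequality and `hK`.
  obtain ⟨s, hs0, hsK, hsW⟩ : ∃ s, a v₀ s = false ∧ (J s).card ≤ K ∧
      ¬ ∃ v, W v ∧ a v₀ s = false ∧ a v s = true ∧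
        η ≤ signalProb q (fun _ t' => samePast σ a v s t') := by
    by_contra! hcon
    have hle := (signalProb_mono h0 hq'.le (E := fun θ t => θ = false ∧ a v₀ t = false)
      (F := fun θ t => (θ = false ∧ ∃ v, W v ∧ a v₀ t = false ∧ a v t = true ∧
        η ≤ signalProb q (fun _ t' => samePast σ a v t t')) ∨ K < (J t).card)
      fun θ t ⟨hθ, ht⟩ => by
        rcases le_or_gt (J t).card K with hle | hlt
        · exact Or.inl ⟨hθ, hcon t ht hle⟩
        · exact Or.inr hlt).trans (signalProb_or_le h0 hq'.le _ _)
    have : (q - 1 / 2) ≤ signalProb q (fun (_ : Bool) t => K < (J t).card) := by linarith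
    have := mul_le_mul_of_nonneg_left this hKpos.le
    linarith
  -- The history of `s` is likely because the signals in `J s` determine it, so no agent of `W` acts
  -- `true`. The others acting `true` lie in `H` or miss a neighbour in `H`.
  have hright : ({v | a v s = true}.ncard : ℝ) ≤ β * n := by
    have hsub : {v | a v s = true} ⊆
        ((H ∪ H.biUnion fun w => Finset.univ.filter fun v => v ≠ w ∧ ¬ G.Adj w v : Finset (Fin n)) :
          Set (Fin n)) := by
      intro v hv
      by_contra hnot
      simp only [Finset.coe_union, Finset.coe_biUnion, Set.mem_union, Finset.mem_coe, not_or,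
        Set.mem_iUnion, Finset.mem_filter, Finset.mem_univ, true_and, not_exists, not_and,
        not_not] at hnot
      obtain ⟨hvH, hvw⟩ := hnot
      refine hsW ⟨v, ⟨?_, hvH, fun w hw => hvw w hw fun e => hvH (e ▸ hw)⟩, hs0, hv, ?_⟩
      · rintro rfl
        rw [Set.mem_ofPred_eq, hs0] at hv
        exact Bool.false_ne_true hv
      · exact (hJη s hsK).trans (signalProb_mono h0 hq'.le fun θ t ht w _ => hact ht.2 w)
    have hcard : {v | a v s = true}.ncard ≤ H.card + H.card * d := by
      refine (Set.ncard_le_ncard hsub (Finset.finite_toSet _)).trans ?_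
      rw [Set.ncard_coe_finset]
      refine (Finset.card_union_le _ _).trans (Nat.add_le_add_left ?_ _)
      refine Finset.card_biUnion_le_card_mul _ _ _ fun w _ => ?_
      by_contra! hlt
      obtain ⟨S, hS, hSd⟩ := Finset.exists_subset_card_eq hlt.le
      obtain ⟨u, hu, hadj⟩ := hG w S (fun hw => (Finset.mem_filter.mp (hS hw)).2.1 rfl) hSd
      exact (Finset.mem_filter.mp (hS hu)).2.2 hadj
    calc ({v | a v s = true}.ncard : ℝ) ≤ ((H.card + H.card * d : ℕ) : ℝ) := by
          exact_mod_cast hcard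
      _ = H.card * (d + 1) := by push_cast; ring
      _ ≤ C / η * (d + 1) := mul_le_mul_of_nonneg_right hH (by positivity)
      _ ≤ β * n := hd
  -- The state is now `true`: whenever the signals in `J s` agree with `s`, all actions are those at
  -- `s`, mostly `false`.
  refine (hJη s hsK).trans (signalProb_mono h0 hq'.le ?_)
  rintro θ t ⟨rfl, ht⟩
  have hst := hact ht
  have hign : ∀ v, IgnoresSignal a v t ↔ IgnoresSignal a v s := fun v =>
    ⟨h.ignoresSignal_of_ignoresSignal fun u _ => (hst u).symm,
      h.ignoresSignal_of_ignoresSignal fun u _ => hst u⟩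
  refine ⟨?_, ?_⟩
  · simp only [hign]
    rw [hJ]
    exact hsK
  · simpa only [hst] using hright

end IsBayesianPlay

/-! ### From wrong herds to learning quality -/

theorem learningQuality_le_one {n : ℕ} {q : ℝ} (h0 : 0 ≤ q) (h1 : q ≤ 1)
    (a : Fin n → (Fin n → Bool) → Bool) : learningQuality q a ≤ 1 := by
  rw [learningQuality, one_div, ← div_eq_inv_mul]
  refine div_le_one_of_le₀ ?_ n.cast_nonneg
  calc ∑ v : Fin n, signalProb q (fun θ s => a v s = θ) ≤ ∑ v : Fin n, (1 : ℝ) :=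
        Finset.sum_le_sum fun v _ => signalProb_le_one h0 h1 _
    _ = n := by simp

theorem learningQuality_le_of_wrongHerd {n : ℕ} (hn : 0 < n) {q : ℝ} (h0 : 0 ≤ q) (h1 : q ≤ 1)
    (K : ℕ) (β : ℝ) (a : Fin n → (Fin n → Bool) → Bool) :
    learningQuality q a ≤ 1 - (1 - β) * signalProb q (WrongHerd K β a) := by
  classical
  have hn' : (0 : ℝ) < n := by exact_mod_cast hn
  rw [learningQuality, one_div, ← div_eq_inv_mul, div_le_iff₀ hn', sum_signalProb_eq]
  have e : (1 - (1 - β) * signalProb q (WrongHerd K β a)) * n =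
      (signalProb (n := n) q (fun _ _ => True) - (1 - β) * signalProb q (WrongHerd K β a)) * n := by
    rw [signalProb_true]
  rw [e]
  simp only [signalProb, Finset.mul_sum, ← Finset.sum_sub_distrib, Finset.sum_mul]
  refine Finset.sum_le_sum fun θ _ => Finset.sum_le_sum fun s _ => ?_
  have hw := jointWeight_nonneg h0 h1 θ s
  by_cases h : WrongHerd K β a θ s
  · have := mul_le_mul_of_nonneg_left h.2 hw
    rw [if_pos h, if_pos trivial]
    linarith
  · have hle : ({v | a v s = θ}.ncard : ℝ) ≤ n := by
      have := Set.ncard_le_ncard (Set.subset_univ {v | a v s = θ})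
      rw [Set.ncard_univ, Nat.card_fin] at this
      exact_mod_cast this
    have := mul_le_mul_of_nonneg_left hle hw
    rw [if_neg h, if_pos trivial]
    linarith

theorem optimalLearningQuality_le {n : ℕ} {q : ℝ} (G : SimpleGraph (Fin n)) {B : ℝ}
    (h : ∀ (σ : Equiv.Perm (Fin n)) (a : Fin n → (Fin n → Bool) → Bool),
      IsBayesianPlay G q σ a → learningQuality q a ≤ B) : optimalLearningQuality q G ≤ B := by
  obtain ⟨a, ha⟩ := exists_isBayesianPlay G q (Equiv.refl _)
  refine csSup_le ⟨_, Equiv.refl _, a, ha, rfl⟩ ?_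
  rintro _ ⟨σ, a, ha, rfl⟩
  exact h σ a ha

theorem measurableSingletonClass_simpleGraph (V : Type*) [Countable V] :
    MeasurableSingletonClass (SimpleGraph V) := by
  refine ⟨fun G => SimpleGraph.measurableEmbedding_edgeSet.measurableSet_image.mp ?_⟩
  rw [Set.image_singleton]
  exact MeasurableSet.singleton _

theorem erLearningQuality_le {n : ℕ} {q : ℝ} (p : unitInterval) (S : Set (SimpleGraph (Fin n)))
    {δ : ℝ} (h1 : ∀ G : SimpleGraph (Fin n), optimalLearningQuality q G ≤ 1)
    (hS : ∀ G ∈ S, optimalLearningQuality q G ≤ 1 - δ) :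
    erLearningQuality q n p ≤ 1 - δ * (SimpleGraph.binomialRandom (Fin n) p).real S := by
  classical
  have := measurableSingletonClass_simpleGraph (Fin n)
  set μ := SimpleGraph.binomialRandom (Fin n) p
  have e1 : ∑ G : SimpleGraph (Fin n), μ.real {G} = 1 := by
    rw [MeasureTheory.sum_measureReal_singleton, Finset.coe_univ, MeasureTheory.probReal_univ]
  have e2 : ∑ G : SimpleGraph (Fin n), (if G ∈ S then μ.real {G} else 0) = μ.real S := by
    rw [← Finset.sum_filter, MeasureTheory.sum_measureReal_singleton]
    simp
  have e3 : erLearningQuality q n p = ∑ G : SimpleGraph (Fin n),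
      μ.real {G} * optimalLearningQuality q G := by
    rw [erLearningQuality]
  rw [e3, ← e1, ← e2, Finset.mul_sum, ← Finset.sum_sub_distrib]
  refine Finset.sum_le_sum fun G _ => ?_
  have hμ : 0 ≤ μ.real {G} := MeasureTheory.measureReal_nonneg
  by_cases hG : G ∈ S
  · rw [if_pos hG]
    linarith [mul_le_mul_of_nonneg_left (hS G hG) hμ]
  · rw [if_neg hG]
    linarith [mul_le_mul_of_nonneg_left (h1 G) hμ]

/-- Wrong herds of constant probability in random graphs prevent asymptotic truth learning. -/
theorem not_erAchievesTruthLearning {q : ℝ} (h0 : 0 ≤ q) (h1 : q ≤ 1) {p : ℕ → unitInterval}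
    {c : ℝ} (hc : 0 < c) (K : ℕ)
    (h : Tendsto (fun n : ℕ => (SimpleGraph.binomialRandom (Fin n) (p n)).real
        {G | ∀ (σ : Equiv.Perm (Fin n)) (a : Fin n → (Fin n → Bool) → Bool),
          IsBayesianPlay G q σ a → c ≤ signalProb q (WrongHerd K (1 / 2) a)}) atTop (𝓝 1)) :
    ¬ ERAchievesTruthLearning q p := by
  intro hlearn
  have hlim := (h.const_mul (c / 2)).const_sub 1
  have hle := le_of_tendsto_of_tendsto hlearn hlim <| by
    filter_upwards [eventually_gt_atTop 0] with n hn
    refine erLearningQuality_le (p n) _ (fun G => optimalLearningQuality_le G fun σ a _ =>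
      learningQuality_le_one h0 h1 a) fun G hG => optimalLearningQuality_le G fun σ a ha => ?_
    have := learningQuality_le_of_wrongHerd hn h0 h1 K (1 / 2) a
    have := hG σ a ha
    linarith
  linarith

/-! ### Choice of constants and conclusion -/

theorem mainTheorem9 (q : ℝ) (hq : 1 / 2 < q) (hq' : q < 1)
    (ε : ℝ) (hε : 0 < ε) (hε' : ε < 1) (p : ℕ → unitInterval)
    (hp : (fun n : ℕ => 1 - (p n : ℝ)) =O[atTop] fun n : ℕ => (n : ℝ) ^ ε / (n : ℝ)) :
    ¬ ERAchievesTruthLearning q p ∧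
    (∃ K : ℕ, Tendsto (fun n : ℕ => (SimpleGraph.binomialRandom (Fin n) (p n)).real
        {G | (∀ S : Finset (Fin n), (G.induce (S : Set (Fin n))).IsAcyclic → S.card ≤ K) ∧
          ∀ σ : Equiv.Perm (Fin n), {v | (earlierNeighbors G σ v).card < 2}.ncard ≤ K})
      atTop (𝓝 1)) ∧
    ∃ c : ℝ, 0 < c ∧ ∃ K : ℕ, ∀ β : ℝ, 0 < β →
      Tendsto (fun n : ℕ => (SimpleGraph.binomialRandom (Fin n) (p n)).real
        {G | ∀ (σ : Equiv.Perm (Fin n)) (a : Fin n → (Fin n → Bool) → Bool),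
          IsBayesianPlay G q σ a → c ≤ signalProb q (WrongHerd K β a)})
      atTop (𝓝 1) := by
  have h1q : 0 < 1 - q := by linarith
  have hq2 : 0 < q - 1 / 2 := by linarith
  obtain ⟨j, hj⟩ := exists_nat_gt (1 / (1 - ε))
  rw [div_lt_iff₀ (by linarith)] at hj
  -- Here `m = 2 * (j + 1) * N` and `k + 1 = 2 * (j + 1)`, so `(1 - ε) * j > 1` yields both sparsity
  -- conditions. At the same time `m` is about half of all pairs among `N` vertices, leaving room
  -- for `k * N` edges.
  let k : ℕ := 2 * j + 1
  let N : ℕ := 8 * (j + 1)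
  let m : ℕ := 16 * (j + 1) ^ 2
  have hchoose : m + k * N ≤ N.choose 2 := by
    have : N.choose 2 = (j + 1) * (32 * j + 28) := by
      rw [Nat.choose_two_right, show N - 1 = 8 * j + 7 by omega]
      refine Nat.div_eq_of_eq_mul_left (by norm_num) ?_
      simp only [N]
      ring
    rw [this]
    simp only [m, k, N]
    nlinarith
  have hchoose1 : m + 1 * N ≤ N.choose 2 :=
    le_trans (Nat.add_le_add_left (Nat.mul_le_mul_right _ (by omega)) _) hchoose
  have hlim : Tendsto (fun n => (SimpleGraph.binomialRandom (Fin n) (p n)).real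
      {G | ¬ ComplLocallySparse G N m}) atTop (𝓝 0) := by
    refine tendsto_real_not_complLocallySparse hp ?_
    simp only [N, m]
    push_cast
    nlinarith
  have hlim' : Tendsto (fun n => (SimpleGraph.binomialRandom (Fin n) (p n)).real
      {G | ¬ ComplLocallySparse G (2 * (k + 1)) ((k + 1) * (k + 1))}) atTop (𝓝 0) := by
    refine tendsto_real_not_complLocallySparse hp ?_
    simp only [k]
    push_cast
    nlinarith
  have part3 : ∃ c : ℝ, 0 < c ∧ ∃ K : ℕ, ∀ β : ℝ, 0 < β →
      Tendsto (fun n : ℕ => (SimpleGraph.binomialRandom (Fin n) (p n)).real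
        {G | ∀ (σ : Equiv.Perm (Fin n)) (a : Fin n → (Fin n → Bool) → Bool),
          IsBayesianPlay G q σ a → c ≤ signalProb q (WrongHerd K β a)}) atTop (𝓝 1) := by
    set C : ℝ := 2 * N + ((1 - q) * (q - 1 / 2))⁻¹ * (2 * N) with hC
    have hN0 : (0 : ℝ) < N := by exact_mod_cast (by omega : 0 < N)
    have hC0 : 0 < C := by positivity
    obtain ⟨K, hK⟩ := exists_nat_gt (C / (q - 1 / 2))
    rw [div_lt_iff₀ hq2] at hK
    have hc0 : 0 < (1 / 2) * (1 - q) ^ K := by positivity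
    refine ⟨(1 / 2) * (1 - q) ^ K, hc0, K, fun β hβ => ?_⟩
    set D : ℝ := C / ((1 / 2) * (1 - q) ^ K) with hD
    have hD0 : 0 < D := by positivity
    -- At most `D` agents lie in `H`, so their non-neighbours use up `β * n / 2`; rounding costs `2
    -- * D`, absorbed once `n ≥ 4 * D / β`. The constants `c` and `K` do not depend on `β`.
    have hdeg := tendsto_real_not_complDegreeLT hε' hp (β := β / (2 * D)) (by positivity)
    refine tendsto_binomialRandom_real_one
      (B := fun n => {G | ¬ ComplLocallySparse G N m} ∪
        ({G | ¬ ComplLocallySparse G (2 * (k + 1)) ((k + 1) * (k + 1))} ∪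
          {G | ¬ ComplDegreeLT G ⌈β / (2 * D) * n⌉₊})) ?_ ?_
    · refine squeeze_zero (fun n => MeasureTheory.measureReal_nonneg) (fun n => ?_)
        (by simpa using hlim.add (hlim'.add hdeg))
      exact (MeasureTheory.measureReal_union_le _ _).trans
        (add_le_add_right (MeasureTheory.measureReal_union_le _ _) _)
    · have hlarge := (tendsto_natCast_atTop_atTop (R := ℝ)).eventually_ge_atTop (4 * D / β)
      filter_upwards [eventually_gt_atTop 0, hlarge] with n hn hnD
      rw [Set.compl_subset_comm]
      intro G hG σ a ha
      simp only [Set.mem_compl_iff, Set.mem_union, Set.mem_ofPred_eq, not_or, not_not] at hG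
      obtain ⟨hG1, hG2, hG3⟩ := hG
      refine ha.le_signalProb_wrongHerd hq hq' hn
        (hG1.sum_signalProb_not_ignoresSignal_le hchoose hG2 hq hq' ha) hK hG3 ?_
      rw [← hC, ← hD]
      have hceil : ((⌈β / (2 * D) * n⌉₊ : ℕ) : ℝ) ≤ β / (2 * D) * n + 1 :=
        (Nat.ceil_lt_add_one (by positivity)).le
      rw [div_le_iff₀ hβ] at hnD
      calc D * ((⌈β / (2 * D) * n⌉₊ : ℕ) + 1 : ℝ) ≤ D * (β / (2 * D) * n + 1 + 1) := by gcongr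
        _ = β * n / 2 + 2 * D := by field_simp; ring
        _ ≤ β * n := by linarith
  refine ⟨?_, ⟨2 * N, ?_⟩, part3⟩
  · obtain ⟨c, hc, K, h⟩ := part3
    exact not_erAchievesTruthLearning (by linarith) hq'.le hc K (h (1 / 2) (by norm_num))
  · refine tendsto_binomialRandom_real_one hlim (Eventually.of_forall fun n => ?_)
    rw [Set.compl_subset_comm]
    intro G hG
    simp only [Set.mem_compl_iff, Set.mem_ofPred_eq, not_not] at hG
    refine ⟨fun S hS => (hG.card_lt_of_isAcyclic (by omega) S hS).le, fun σ => ?_⟩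
    have hA := hG.card_lt_of_earlierNeighbors hchoose1 σ
      (Finset.univ.filter fun v => (earlierNeighbors G σ v).card < 2) fun v hv =>
        (Finset.card_filter_le _ _).trans (Nat.lt_succ_iff.mp (Finset.mem_filter.mp hv).2)
    rw [← Set.ncard_coe_finset] at hA
    simp only [Finset.coe_filter, Finset.mem_univ, true_and] at hA
    omega

end
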